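/- **Setting.** Let $n\ge 1$ be an integer and let $X$ be a compact Hausdorff space equipped with: a dense linear subspace $\mathcal D\subset C^0(X)$ (test functions) containing the constants; a partially ordered real vector space $\mathcal Z$ (closed $(1,1)$-forms) whose cone $\mathcal Z_+=\{\theta\ge 0\}$ spans $\mathcal Z$ and is closed in the finest vector space topology (a set is closed, resp. open, iff its intersection with each finite-dimensional subspace is); a linear map $\mathrm{dd^c}\colon\mathcal D\to\mathcal Z$ vanishing on constants; and a nonzero symmetric $n$-linear map $(\theta_1,\dots,\theta_n)\mapsto\theta_1\wedge\dots\wedge\theta_n$ from $\mathcal Z^n$ to signed Radon measures on $X$, positive when all $\theta_i\ge 0$, such that for all $\theta_i\in\mathcal Z$ the form $(\varphi,\psi)\mapsto\int\varphi\,\mathrm{dd^c}\psi\wedge\theta_1\wedge\dots\wedge\theta_{n-1}$ on $\mathcal D\times\mathcal D$ is symmetric, and seminegative if all $\theta_i\ge 0$. For $\theta\in\mathcal Z$ put $\mathcal D_\theta=\{\varphi\in\mathcal D\mid\theta+\mathrm{dd^c}\varphi\ge 0\}$. The positive cone is the interior, in the finest vector space topology of $\mathcal Z/\mathrm{dd^c}\mathcal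 D$, of the image of $\mathcal Z_+$. The energy pairing $(\theta_0,\varphi_0)\cdot\ldots\cdot(\theta_n,\varphi_n)$ is the unique symmetric $(n+1)$-linear form on $\mathcal Z\times\mathcal D$ with $(0,\varphi_0)\cdot(\theta_1,\varphi_1)\cdot\ldots\cdot(\theta_n,\varphi_n)=\int\varphi_0\,(\theta_1+\mathrm{dd^c}\varphi_1)\wedge\dots\wedge(\theta_n+\mathrm{dd^c}\varphi_n)$ and $(\theta_0,0)\cdot\ldots\cdot(\theta_n,0)=0$; explicitly it equals $$\sum_{i=0}^n\int\varphi_i\,\theta_0\wedge\dots\wedge\theta_{i-1}\wedge(\theta_{i+1}+\mathrm{dd^c}\varphi_{i+1})\wedge\dots\wedge(\theta_n+\mathrm{dd^c}\varphi_n).$$ Fix $\omega\in\mathcal Z_+$ whose class lies in the positive cone. Put $V_\omega=\int\omega^n$, $\mu_\omega=V_\omega^{-1}\omega^n$, and for $\varphi,\psi\in\mathcal D_\omega$ $$\mathrm{MA}_\omega(\varphi)=V_\omega^{-1}(\omega+\mathrm{dd^c}\varphi)^n,\qquad \mathrm E_\omega(\varphi)=\frac{(\omega,\varphi)^{n+1}}{(n+1)V_\omega},$$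 $$\mathrm J_\omega(\varphi,\psi)=\mathrm E_\omega(\varphi)-\mathrm E_\omega(\psi)+\int(\psi-\varphi)\,\mathrm{MA}_\omega(\varphi),\qquad \mathrm J^+_\omega(\varphi)=\mathrm J_\omega(0,\varphi)+T_\omega,$$ where $T_\omega=\sup_{\varphi\in\mathcal D_\omega}\bigl(\sup\varphi-\int\varphi\,\mu_\omega\bigr)$. For $\theta\in\mathcal Z$ put $\|\theta\|_\omega=\inf\{C\ge 0\mid\pm\theta\le C\omega\}\in[0,+\infty]$ and $\mathcal Z_\omega=\{\theta\mid\|\theta\|_\omega<\infty\}$. Assume: * the submean value property: $T_{\omega'}<\infty$ for some $\omega'\in\mathcal Z_+$ whose class lies in the positive cone (this is known to be equivalent to the same property for every such $\omega'$, in particular for $\omega$); * the orthogonality property of $\omega$: (a) for all $\varphi,\psi\in\mathcal D_\omega$ and $f\in\mathcal D$ with $\max\{\varphi,\psi\}<f$ there is $\tau\in\mathcal D_\omega$ with $\max\{\varphi,\psi\}\le\tau<f$; (b) for all $f\in\mathcal D$ and $\varepsilon>0$ there is $\varphi_0\in\mathcal D_\omega$ with $\varphi_0<f$ such that $\int(f-\varphi)\,\mathrm{MA}_\omega(\varphi)\le\varepsilon$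 for all $\varphi\in\mathcal D_\omega$ with $\varphi_0\le\varphi<f$. **Theorem.** There is a constant $C_n>0$ depending only on $n$ such that in every such situation the following holds. For $i=0,\dots,n$ let $\theta_i,\theta'_i\in\mathcal Z_\omega$ and let $\varphi_i,\varphi'_i\in\mathcal D_\omega$ be normalized by $\int\varphi_i\,\mu_\omega=\int\varphi'_i\,\mu_\omega=0$. Then $$\bigl|(\theta_0,\varphi_0)\cdot\ldots\cdot(\theta_n,\varphi_n)-(\theta'_0,\varphi'_0)\cdot\ldots\cdot(\theta'_n,\varphi'_n)\bigr|\le C_n\,A\Bigl(\max_i\|\theta_i-\theta'_i\|_\omega\,J+\max_i\mathrm J_\omega(\varphi_i,\varphi'_i)^{\alpha}\,J^{1-\alpha}\Bigr)$$ with $\alpha=2^{-n}$, $$A=V_\omega\prod_{i=0}^n\bigl(1+\|\theta_i\|_\omega+\|\theta'_i\|_\omega\bigr),\qquad J=\max_i\max\{\mathrm J^+_\omega(\varphi_i),\mathrm J^+_\omega(\varphi'_i)\}.$$ Moreover $$\bigl|(\theta_0,\varphi_0)\cdot\ldots\cdot(\theta_n,\varphi_n)\bigr|\le C_n\,V_\omega\prod_{i=0}^n\bigl(1+\|\theta_i\|_\omega\bigr)\,\max_i\mathrm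 J^+_\omega(\varphi_i).$$ -/

import Mathlib

noncomputable section

/-- The topology on a real vector space `V` generated by its finite dimensional subspaces: a set is
open (closed) iff its preimage under every linear map `ℝᵏ → V` is open (closed), equivalently iff
its intersection with every finite dimensional subspace is so for the canonical topology. -/
abbrev finestTopology (V : Type*) [AddCommGroup V] [Module ℝ V] : TopologicalSpace V :=
  ⨆ (k : ℕ) (f : (Fin k → ℝ) →ₗ[ℝ] V), TopologicalSpace.coinduced f inferInstance

/-- The synthetic pluripotential setup of dimension `n` on a compact Hausdorff space `X`, with
partially ordered real vector space `Z` of closed `(1,1)`-forms.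
Signed Radon measures on `X` are the continuous linear functionals on `C(X, ℝ)`
(Riesz representation), with `∫ f μ` written `μ f`; a measure is positive iff it is nonnegative
on nonnegative functions. -/
structure PluripotentialSetup (X : Type*) [TopologicalSpace X] [CompactSpace X] [T2Space X]
    (Z : Type*) [AddCommGroup Z] [Module ℝ Z] [PartialOrder Z] [IsOrderedAddMonoid Z]
    [IsOrderedModule ℝ Z] (n : ℕ) where
  /-- The positive forms span `Z`. -/
  span_nonneg : Submodule.span ℝ {θ : Z | 0 ≤ θ} = ⊤
  /-- The cone of positive forms is closed. -/
  isClosed_nonneg : @IsClosed _ (finestTopology Z) {θ : Z | 0 ≤ θ}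
  /-- The test functions. -/
  D : Submodule ℝ C(X, ℝ)
  dense_D : Dense (D : Set C(X, ℝ))
  const_mem : ∀ c : ℝ, ContinuousMap.const X c ∈ D
  /-- The operator `ddᶜ`. -/
  ddc : D →ₗ[ℝ] Z
  ddc_const : ∀ c : ℝ, ddc ⟨ContinuousMap.const X c, const_mem c⟩ = 0
  /-- The product `(θ₁, …, θₙ) ↦ θ₁ ∧ ⋯ ∧ θₙ`, with values in signed Radon measures. -/
  wedge : MultilinearMap ℝ (fun _ : Fin n => Z) (C(X, ℝ) →L[ℝ] ℝ)
  wedge_ne_zero : wedge ≠ 0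
  wedge_symm : ∀ (σ : Equiv.Perm (Fin n)) (θ : Fin n → Z), wedge (fun j => θ (σ j)) = wedge θ
  wedge_nonneg : ∀ θ : Fin n → Z, (∀ j, 0 ≤ θ j) → ∀ f : C(X, ℝ), 0 ≤ f → 0 ≤ wedge θ f
  /-- `∫ φ ddᶜψ ∧ θ₁ ∧ ⋯ ∧ θₙ₋₁` is symmetric in `φ, ψ`
  (`ddᶜψ` is put in the slot `j`, the other slots are arbitrary). -/
  integration_by_parts : ∀ (j : Fin n) (θ : Fin n → Z) (φ ψ : D),
    wedge (Function.update θ j (ddc ψ)) φ = wedge (Function.update θ j (ddc φ)) ψ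
  /-- `∫ φ ddᶜφ ∧ θ₁ ∧ ⋯ ∧ θₙ₋₁ ≤ 0` for `θᵢ ≥ 0`. -/
  seminegative : ∀ (j : Fin n) (θ : Fin n → Z), (∀ i, 0 ≤ θ i) → ∀ φ : D,
    wedge (Function.update θ j (ddc φ)) φ ≤ 0

namespace PluripotentialSetup

variable {X : Type*} [TopologicalSpace X] [CompactSpace X] [T2Space X]
  {Z : Type*} [AddCommGroup Z] [Module ℝ Z] [PartialOrder Z] [IsOrderedAddMonoid Z]
  [IsOrderedModule ℝ Z] {n : ℕ} (S : PluripotentialSetup X Z n)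

/-- The Bott–Chern cohomology space `Z / ddᶜ D`. -/
abbrev BottChern : Type _ := Z ⧸ LinearMap.range S.ddc

/-- The Bott–Chern class `[θ]`. -/
def cls (θ : Z) : S.BottChern := (LinearMap.range S.ddc).mkQ θ

/-- The positive cone: the interior of the set of classes of positive forms. -/
def Pos : Set S.BottChern :=
  @interior _ (finestTopology S.BottChern) (S.cls '' {θ : Z | 0 ≤ θ})

/-- The set `D_θ` of `θ`-psh test functions. -/
def psh (θ : Z) : Set S.D := {φ | 0 ≤ θ + S.ddc φ}

/-- The energy pairing `(θ₀, φ₀) ⋯ (θₙ, φₙ)`, that is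
`∑ᵢ ∫ φᵢ θ₀ ∧ ⋯ ∧ θᵢ₋₁ ∧ (θᵢ₊₁ + ddᶜφᵢ₊₁) ∧ ⋯ ∧ (θₙ + ddᶜφₙ)`; this is the unique
symmetric multilinear map with `(0, φ₀) · (θ₁, φ₁) ⋯ (θₙ, φₙ) = ∫ φ₀ ⋀ᵢ (θᵢ + ddᶜφᵢ)` and
`(θ₀, 0) ⋯ (θₙ, 0) = 0`. -/
def pairing (θ : Fin (n + 1) → Z) (φ : Fin (n + 1) → S.D) : ℝ :=
  ∑ i : Fin (n + 1),
    S.wedge (fun j : Fin n =>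
      if i.succAbove j < i then θ (i.succAbove j)
      else θ (i.succAbove j) + S.ddc (φ (i.succAbove j))) (φ i)

/-- The volume `V_ω = ∫ ωⁿ`. -/
def vol (ω : Z) : ℝ := S.wedge (fun _ => ω) 1

/-- The Monge–Ampère measure `MA_ω(φ) = V_ω⁻¹ (ω + ddᶜφ)ⁿ`. -/
def MA (ω : Z) (φ : S.D) : C(X, ℝ) →L[ℝ] ℝ :=
  (S.vol ω)⁻¹ • S.wedge (fun _ => ω + S.ddc φ)

/-- The measure `μ_ω = V_ω⁻¹ ωⁿ`. -/
def mu (ω : Z) : C(X, ℝ) →L[ℝ] ℝ := (S.vol ω)⁻¹ • S.wedge (fun _ => ω)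

/-- The Monge–Ampère energy. -/
def energy (ω : Z) (φ : S.D) : ℝ :=
  S.pairing (fun _ => ω) (fun _ => φ) / ((n + 1 : ℝ) * S.vol ω)

/-- The Dirichlet functional `J_ω(φ, ψ)`. -/
def dirichlet (ω : Z) (φ ψ : S.D) : ℝ :=
  S.energy ω φ - S.energy ω ψ + S.MA ω φ ((ψ - φ : S.D) : C(X, ℝ))

/-- The set of all `sup φ - ∫ φ μ_ω`, where `φ` is an `ω`-psh test function. -/
def submeanSet (ω : Z) : Set ℝ :=
  {t | ∃ φ ∈ S.psh ω, t = (⨆ x : X, (φ : C(X, ℝ)) x) - S.mu ω φ}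

/-- The constant `T_ω`; it is finite iff `submeanSet ω` is bounded above. -/
def submeanConst (ω : Z) : ℝ := sSup (S.submeanSet ω)

/-- The submean value property: `T_ω < ∞` for some `ω ≥ 0` of positive class. -/
def SubmeanProperty : Prop :=
  ∃ ω : Z, 0 ≤ ω ∧ S.cls ω ∈ S.Pos ∧ BddAbove (S.submeanSet ω)

/-- `J⁺_ω(φ) = J_ω(0, φ) + T_ω`. -/
def Jplus (ω : Z) (φ : S.D) : ℝ := S.dirichlet ω 0 φ + S.submeanConst ω

/-- `D_ω` admits maxima. -/
def AdmitsMaxima (ω : Z) : Prop :=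
  ∀ φ ∈ S.psh ω, ∀ ψ ∈ S.psh ω, ∀ f : S.D,
    (∀ x : X, max ((φ : C(X, ℝ)) x) ((ψ : C(X, ℝ)) x) < (f : C(X, ℝ)) x) →
    ∃ τ ∈ S.psh ω, ∀ x : X,
      max ((φ : C(X, ℝ)) x) ((ψ : C(X, ℝ)) x) ≤ (τ : C(X, ℝ)) x ∧
        (τ : C(X, ℝ)) x < (f : C(X, ℝ)) x

/-- The orthogonality property of `ω`: `D_ω` admits maxima, and for each test function `f` the
integrals `∫ (f - φ) MA_ω(φ)` tend to `0` along the directed set of `ω`-psh `φ < f`. -/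
def Orthogonality (ω : Z) : Prop :=
  S.AdmitsMaxima ω ∧
  ∀ (f : S.D) (ε : ℝ), 0 < ε →
    ∃ φ₀ ∈ S.psh ω, (∀ x : X, (φ₀ : C(X, ℝ)) x < (f : C(X, ℝ)) x) ∧
      ∀ φ ∈ S.psh ω,
        (∀ x : X, (φ₀ : C(X, ℝ)) x ≤ (φ : C(X, ℝ)) x ∧
          (φ : C(X, ℝ)) x < (f : C(X, ℝ)) x) →
        S.MA ω φ ((f - φ : S.D) : C(X, ℝ)) ≤ ε

end PluripotentialSetup

/-- The set of all `C ≥ 0` with `±θ ≤ C ω`. -/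
def formBounds {Z : Type*} [AddCommGroup Z] [Module ℝ Z] [PartialOrder Z] (ω θ : Z) : Set ℝ :=
  {C | 0 ≤ C ∧ θ ≤ C • ω ∧ -θ ≤ C • ω}

/-- `θ` is `ω`-bounded, that is `‖θ‖_ω < ∞`. -/
def FormBounded {Z : Type*} [AddCommGroup Z] [Module ℝ Z] [PartialOrder Z] (ω θ : Z) : Prop :=
  (formBounds ω θ).Nonempty

/-- The norm `‖θ‖_ω = inf {C ≥ 0 | ±θ ≤ C ω}` of an `ω`-bounded form `θ`. -/
def formNorm {Z : Type*} [AddCommGroup Z] [Module ℝ Z] [PartialOrder Z] (ω θ : Z) : ℝ :=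
  sInf (formBounds ω θ)

end

/-! Write n = m + 1, ω_ψ = ω + ddᶜψ and D(u, v; Γ) = -∫ u ddᶜv ∧ Γ. For Γ ≥ 0 the form D is positive
semidefinite, so a Cauchy-Schwarz inequality holds, also for entries merely dominated by positive
forms (`abs_dirForm_le`).

Exponent. The energy E is concave with gradient MA, and J_ω(φ, φ') is its defect from the tangent.
It therefore controls Q = D(u, u; ω_χ, …, ω_χ), where u = φ - φ' and χ is the midpoint
(`dirForm_midpoint_le_dirichlet`). To reach other entries ω_ψ, they are replaced one at a time: ω_ψ
- ω_χ = ddᶜ(ψ - χ) can be exchanged with ddᶜu, and ± ddᶜu ≤ 2 ω_χ. Cauchy-Schwarz then bounds the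
new Dirichlet form by √B times the square root of the old one, where B is an a priori bound of order
V_ω K coming from concavity of E. The m replacements and one last Cauchy-Schwarz inequality give the
exponent 2⁻ⁿ (`dirForm_sub_self_piecewise_le`, `abs_dirForm_sub_le`).

Forms not cohomologous to ω. The above handles exact entries. What remains is ∫ u θ₁ ∧ ⋯ ∧ θₙ with ±
θⱼ ≤ bⱼ ω, and this reduces to ν(u) for a probability ν ≤ 2 μ_ω. If MA(h) were equal to ν, the first
part would apply. Instead, let ψ nearly maximize E - ν, and let h < ψ + u be ω-psh with ∫ (ψ + u -
h) MA(h) small, by orthogonality. Concavity of E at h and near-maximality of ψ give ∫ u MA(h) ≤ ν(u)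
+ small. The energy bound of h is at most 4K + |∫ u MA(h)|, and this integral grows sublinearly in
that bound, so it stays below a constant times K (`neg_modulus_le_measure`). Exchanging φ and φ'
gives the other sign.

The pairing is a sum of integrals, compared by changing the function first and then one form at a
time; integration by parts brings each change into one of these two cases (`abs_pairing_sub_le`). -/

noncomputable section

/-! ### Multilinear maps on ordered vector spaces -/

section Multilinear

variable {Z : Type*} [AddCommGroup Z] [Module ℝ Z]

/-- If replacing one slot changes a multilinear map by at most `c`, then replacing all slots changes
it by at most `k * c`. -/
theorem MultilinearMap.abs_sub_le_of_update {k : ℕ}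
    (M : MultilinearMap ℝ (fun _ : Fin k => Z) ℝ) (a b : Fin k → Z) (c : ℝ)
    (h : ∀ (s : Finset (Fin k)) (j : Fin k), j ∉ s →
      |M (Function.update (s.piecewise a b) j (a j - b j))| ≤ c) :
    |M a - M b| ≤ k * c := by
  have key : ∀ s : Finset (Fin k), |M (s.piecewise a b) - M b| ≤ s.card * c := by
    intro s
    induction s using Finset.induction_on with
    | empty => simp
    | insert j s hj ih =>
      have h1 := h s j hj
      have h2 : M ((insert j s).piecewise a b) - M (s.piecewise a b) =
          M (Function.update (s.piecewise a b) j (a j - b j)) := by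
        rw [Finset.piecewise_insert, M.map_update_sub]
        congr 2
        rw [Function.eq_update_iff]
        simp [hj]
      have h3 : M ((insert j s).piecewise a b) - M b =
          M (Function.update (s.piecewise a b) j (a j - b j)) + (M (s.piecewise a b) - M b) := by
        rw [← h2]; ring
      rw [h3, Finset.card_insert_of_notMem hj]
      push_cast
      calc _ ≤ _ := abs_add_le _ _
        _ ≤ c + s.card * c := add_le_add h1 ih
        _ = _ := by ring
  simpa using key Finset.univ

/-- The derivative of a multilinear map along an affine path. -/
theorem MultilinearMap.hasDerivAt_affine {k : ℕ} (M : MultilinearMap ℝ (fun _ : Fin k => Z) ℝ)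
    (p q : Fin k → Z) (t : ℝ) :
    HasDerivAt (fun t : ℝ => M (fun j => p j + t • q j))
      (∑ j, M (Function.update (fun j => p j + t • q j) j (q j))) t := by
  induction k with
  | zero =>
    simp only [Finset.univ_eq_empty, Finset.sum_empty]
    have : (fun t : ℝ => M (fun j => p j + t • q j)) = fun _ => M 0 := by
      ext t; congr 1; exact Subsingleton.elim _ _
    rw [this]
    exact hasDerivAt_const _ _
  | succ k ih =>
    have e : ∀ t : ℝ, (fun j => p j + t • q j) =
        Fin.cons (p 0 + t • q 0) (fun j : Fin k => p j.succ + t • q j.succ) := by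
      intro t
      ext j
      refine Fin.cases ?_ (fun j => ?_) j <;> simp
    have h0 : ∀ t : ℝ, M (fun j => p j + t • q j) =
        M.curryLeft (p 0) (fun j : Fin k => p j.succ + t • q j.succ)
        + t * M.curryLeft (q 0) (fun j : Fin k => p j.succ + t • q j.succ) := by
      intro t
      rw [e t, ← MultilinearMap.curryLeft_apply, map_add, map_smul]
      simp
    have hp := ih (M.curryLeft (p 0)) (fun j => p j.succ) (fun j => q j.succ)
    have hq := ih (M.curryLeft (q 0)) (fun j => p j.succ) (fun j => q j.succ)
    have H := hp.add ((hasDerivAt_id t).mul hq)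
    have : (fun t : ℝ => M (fun j => p j + t • q j)) = (fun t =>
        M.curryLeft (p 0) (fun j : Fin k => p j.succ + t • q j.succ)
        + id t * M.curryLeft (q 0) (fun j : Fin k => p j.succ + t • q j.succ)) := by
      ext t; exact h0 t
    rw [this]
    refine HasDerivAt.congr_deriv H ?_
    rw [Fin.sum_univ_succ, e t, Fin.update_cons_zero]
    have h1 : ∀ j : Fin k, M (Function.update (Fin.cons (p 0 + t • q 0)
        (fun j : Fin k => p j.succ + t • q j.succ)) j.succ (q j.succ)) =
        M.curryLeft (p 0) (Function.update (fun j : Fin k => p j.succ + t • q j.succ) j (q j.succ))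
        + t * M.curryLeft (q 0)
          (Function.update (fun j : Fin k => p j.succ + t • q j.succ) j (q j.succ)) := by
      intro j
      rw [← Fin.cons_update, ← MultilinearMap.curryLeft_apply, map_add, map_smul]
      simp
    rw [Finset.sum_congr rfl (fun j _ => h1 j), Finset.sum_add_distrib, ← Finset.mul_sum]
    simp
    ring

variable [PartialOrder Z] [IsOrderedAddMonoid Z] [IsOrderedModule ℝ Z]

/-- A positive multilinear map is monotone under two-sided domination of its arguments. -/
theorem MultilinearMap.abs_le_of_abs_le {k : ℕ} (M : MultilinearMap ℝ (fun _ : Fin k => Z) ℝ)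
    (hM : ∀ ζ, (∀ j, 0 ≤ ζ j) → 0 ≤ M ζ) (ζ γ : Fin k → Z)
    (h1 : ∀ j, ζ j ≤ γ j) (h2 : ∀ j, -ζ j ≤ γ j) : |M ζ| ≤ M γ := by
  have hγ : ∀ j, 0 ≤ γ j := by
    intro j
    have h : (0 : Z) ≤ (2 : ℝ) • γ j := by
      rw [two_smul]
      simpa using add_le_add (h1 j) (h2 j)
    have h' := smul_le_smul_of_nonneg_left h (by norm_num : (0 : ℝ) ≤ 1 / 2)
    simpa [smul_smul] using h'
  have key : ∀ (s : Finset (Fin k)) (γ' : Fin k → Z), (∀ j, 0 ≤ γ' j) →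
      |M (s.piecewise ζ γ')| ≤ M (s.piecewise γ γ') := by
    intro s
    induction s using Finset.induction_on with
    | empty =>
      intro γ' h
      simp [abs_of_nonneg (hM γ' h)]
    | insert a s ha ih =>
      intro γ' h
      have e : ∀ (x : Z) (ζ : Fin k → Z), s.piecewise ζ (Function.update γ' a x) =
          Function.update (s.piecewise ζ γ') a x := by
        intro x ζ
        exact (Finset.update_piecewise_of_notMem s ζ γ' ha x).symm
      -- Polarization: both γ a + ζ a and γ a - ζ a are nonnegative. Adding the two induction
      -- hypotheses leaves twice the desired inequality.
      have hp := ih (Function.update γ' a (γ a + ζ a)) (by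
        intro j
        by_cases hj : j = a
        · subst hj
          simpa [neg_le_iff_add_nonneg] using h2 j
        · simpa [hj] using h j)
      have hm := ih (Function.update γ' a (γ a - ζ a)) (by
        intro j
        by_cases hj : j = a
        · subst hj
          simpa using h1 j
        · simpa [hj] using h j)
      rw [e, e] at hp hm
      rw [M.map_update_add, M.map_update_add] at hp
      rw [M.map_update_sub, M.map_update_sub] at hm
      rw [Finset.piecewise_insert, Finset.piecewise_insert]
      rw [abs_le] at hp hm ⊢
      constructor <;> linarith [hp.1, hp.2, hm.1, hm.2]
  simpa using key Finset.univ γ hγ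

theorem MultilinearMap.le_of_le {k : ℕ} (M : MultilinearMap ℝ (fun _ : Fin k => Z) ℝ)
    (hM : ∀ ζ, (∀ j, 0 ≤ ζ j) → 0 ≤ M ζ) (ζ γ : Fin k → Z)
    (h0 : ∀ j, 0 ≤ ζ j) (h1 : ∀ j, ζ j ≤ γ j) : M ζ ≤ M γ :=
  (le_abs_self _).trans (M.abs_le_of_abs_le hM ζ γ h1
    fun j => (neg_nonpos.2 (h0 j)).trans ((h0 j).trans (h1 j)))

end Multilinear

/-! ### Integrals of wedge products and mixed Dirichlet forms -/

namespace PluripotentialSetup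

variable {X : Type*} [TopologicalSpace X] [CompactSpace X] [T2Space X]
  {Z : Type*} [AddCommGroup Z] [Module ℝ Z] [PartialOrder Z] [IsOrderedAddMonoid Z]
  [IsOrderedModule ℝ Z]

section

variable {n : ℕ} (S : PluripotentialSetup X Z n)

/-- The real multilinear form `(θ₁, …, θₙ) ↦ ∫ f θ₁ ∧ ⋯ ∧ θₙ`. -/
def integral (f : C(X, ℝ)) : MultilinearMap ℝ (fun _ : Fin n => Z) ℝ :=
  LinearMap.compMultilinearMap
    ({ toFun := fun L => L f, map_add' := fun _ _ => rfl, map_smul' := fun _ _ => rfl } :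
      (C(X, ℝ) →L[ℝ] ℝ) →ₗ[ℝ] ℝ) S.wedge

theorem integral_apply (f : C(X, ℝ)) (θ : Fin n → Z) : S.integral f θ = S.wedge θ f := rfl

theorem integral_nonneg {f : C(X, ℝ)} (hf : 0 ≤ f) (θ : Fin n → Z) (h : ∀ j, 0 ≤ θ j) :
    0 ≤ S.integral f θ := S.wedge_nonneg θ h f hf

theorem integral_add (f g : C(X, ℝ)) (θ : Fin n → Z) :
    S.integral (f + g) θ = S.integral f θ + S.integral g θ := map_add (S.wedge θ) f g

theorem integral_sub (f g : C(X, ℝ)) (θ : Fin n → Z) :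
    S.integral (f - g) θ = S.integral f θ - S.integral g θ := map_sub (S.wedge θ) f g

theorem integral_neg (f : C(X, ℝ)) (θ : Fin n → Z) :
    S.integral (-f) θ = -S.integral f θ := map_neg (S.wedge θ) f

theorem integral_smul (c : ℝ) (f : C(X, ℝ)) (θ : Fin n → Z) :
    S.integral (c • f) θ = c * S.integral f θ := map_smul (S.wedge θ) c f

theorem integral_symm (f : C(X, ℝ)) (σ : Equiv.Perm (Fin n)) (θ : Fin n → Z) :
    S.integral f (fun j => θ (σ j)) = S.integral f θ := by
  rw [integral_apply, S.wedge_symm, integral_apply]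

theorem integral_mono {f g : C(X, ℝ)} (h : f ≤ g) (θ : Fin n → Z) (hθ : ∀ j, 0 ≤ θ j) :
    S.integral f θ ≤ S.integral g θ := by
  have := S.integral_nonneg (sub_nonneg.2 h) θ hθ
  rw [integral_sub] at this
  linarith

/-- The constant test function. -/
def constD (c : ℝ) : S.D := ⟨ContinuousMap.const X c, S.const_mem c⟩

theorem ddc_constD (c : ℝ) : S.ddc (S.constD c) = 0 := S.ddc_const c

theorem coe_constD (c : ℝ) : (S.constD c : C(X, ℝ)) = c • (1 : C(X, ℝ)) := by
  ext x; simp [constD]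

theorem integral_ddc_symm (u v : S.D) (j : Fin n) (θ : Fin n → Z) :
    S.integral u (Function.update θ j (S.ddc v)) = S.integral v (Function.update θ j (S.ddc u)) :=
  S.integration_by_parts j θ u v

/-- Exact forms do not contribute to the mass. -/
theorem integral_one_add_ddc (θ : Fin n → Z) (φ : Fin n → S.D) :
    S.integral 1 (fun j => θ j + S.ddc (φ j)) = S.integral 1 θ := by
  have h1 : (S.constD 1 : C(X, ℝ)) = 1 := by rw [coe_constD, one_smul]
  -- Each replacement costs nothing: integration by parts moves `ddc` onto the constant 1, where it
  -- vanishes.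
  have := (S.integral 1).abs_sub_le_of_update (fun j => θ j + S.ddc (φ j)) θ 0 (by
    intro s j _
    rw [add_sub_cancel_left, ← h1, integral_ddc_symm, ddc_constD, MultilinearMap.map_update_zero,
      abs_zero])
  rw [mul_zero] at this
  exact sub_eq_zero.1 (abs_eq_zero.1 (le_antisymm this (abs_nonneg _)))

end

variable {m : ℕ} (S : PluripotentialSetup X Z (m + 1))

/-- The form `(u, v) ↦ -∫ u ddᶜv ∧ Γ₁ ∧ ⋯ ∧ Γₘ`, multilinear in `Γ`. -/
def dirForm (u v : S.D) : MultilinearMap ℝ (fun _ : Fin m => Z) ℝ :=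
  -((S.integral u).curryLeft (S.ddc v))

theorem dirForm_apply (u v : S.D) (Γ : Fin m → Z) :
    S.dirForm u v Γ = -S.integral u (Fin.cons (S.ddc v) Γ) := rfl

theorem dirForm_symm (u v : S.D) (Γ : Fin m → Z) : S.dirForm u v Γ = S.dirForm v u Γ := by
  have := S.integral_ddc_symm u v 0 (Fin.cons 0 Γ)
  rw [Fin.update_cons_zero, Fin.update_cons_zero] at this
  rw [dirForm_apply, dirForm_apply, this]

theorem dirForm_add_left (u u' v : S.D) (Γ : Fin m → Z) :
    S.dirForm (u + u') v Γ = S.dirForm u v Γ + S.dirForm u' v Γ := by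
  simp only [dirForm_apply, Submodule.coe_add, integral_add]
  ring

theorem dirForm_smul_left (c : ℝ) (u v : S.D) (Γ : Fin m → Z) :
    S.dirForm (c • u) v Γ = c * S.dirForm u v Γ := by
  simp only [dirForm_apply, Submodule.coe_smul, integral_smul]
  ring

theorem dirForm_add_right (u v v' : S.D) (Γ : Fin m → Z) :
    S.dirForm u (v + v') Γ = S.dirForm u v Γ + S.dirForm u v' Γ := by
  rw [dirForm_symm, dirForm_add_left, S.dirForm_symm v, S.dirForm_symm v']

theorem dirForm_smul_right (c : ℝ) (u v : S.D) (Γ : Fin m → Z) :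
    S.dirForm u (c • v) Γ = c * S.dirForm u v Γ := by
  rw [dirForm_symm, dirForm_smul_left, S.dirForm_symm v]

theorem dirForm_neg_left (u v : S.D) (Γ : Fin m → Z) :
    S.dirForm (-u) v Γ = -S.dirForm u v Γ := by
  rw [← neg_one_smul ℝ u, dirForm_smul_left]; ring

theorem dirForm_neg_right (u v : S.D) (Γ : Fin m → Z) :
    S.dirForm u (-v) Γ = -S.dirForm u v Γ := by
  rw [dirForm_symm, dirForm_neg_left, dirForm_symm]

theorem dirForm_self_nonneg (u : S.D) (Γ : Fin m → Z) (hΓ : ∀ j, 0 ≤ Γ j) :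
    0 ≤ S.dirForm u u Γ := by
  have h := S.seminegative 0 (Fin.cons 0 Γ) (by
    intro i
    refine Fin.cases ?_ (fun j => ?_) i
    · simp
    · simpa using hΓ j) u
  rw [Fin.update_cons_zero] at h
  rw [dirForm_apply, integral_apply]
  linarith

/-- A form with an exact entry in the slot `j`, in terms of the Dirichlet form. -/
theorem integral_update_ddc (u v : S.D) (j : Fin (m + 1)) (θ : Fin (m + 1) → Z) :
    S.integral u (Function.update θ j (S.ddc v)) = -S.dirForm u v (j.removeNth θ) := by
  rw [dirForm_apply, neg_neg, ← Fin.insertNth_removeNth, ← Fin.cons_comp_cycleRange]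
  exact S.integral_symm _ j.cycleRange _

/-- Exchange of an exact entry with the distinguished one. -/
theorem dirForm_update_ddc (u v w : S.D) (j : Fin m) (Γ : Fin m → Z) :
    S.dirForm u v (Function.update Γ j (S.ddc w)) =
      S.dirForm u w (Function.update Γ j (S.ddc v)) := by
  rw [dirForm_apply, dirForm_apply, ← S.integral_symm _ (Equiv.swap 0 j.succ)]
  congr 2
  ext i
  by_cases hi : i = 0
  · subst hi; simp
  · by_cases hj : i = j.succ
    · subst hj; simp
    · rw [Equiv.swap_apply_of_ne_of_ne hi hj]
      obtain ⟨i, rfl⟩ := Fin.exists_succ_eq_of_ne_zero hi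
      have : i ≠ j := fun h => hj (by rw [h])
      simp [this]

/-- The Cauchy-Schwarz inequality for mixed forms dominated by positive ones. -/
theorem abs_dirForm_le (u v : S.D) (ζ γ : Fin m → Z)
    (h1 : ∀ j, ζ j ≤ γ j) (h2 : ∀ j, -ζ j ≤ γ j) :
    |S.dirForm u v ζ| ≤ √(S.dirForm u u γ) * √(S.dirForm v v γ) := by
  have dom : ∀ w : S.D, |S.dirForm w w ζ| ≤ S.dirForm w w γ := fun w =>
    (S.dirForm w w).abs_le_of_abs_le (S.dirForm_self_nonneg w) ζ γ h1 h2
  have hu : 0 ≤ S.dirForm u u γ := (abs_nonneg _).trans (dom u)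
  rw [← Real.sqrt_mul hu]
  refine Real.abs_le_sqrt ?_
  -- The domination is applied to both t u + v and t u - v: subtracting isolates the cross term at
  -- ζ, while the cross terms at γ cancel in the sum of the bounds. The discriminant then gives the
  -- inequality.
  have key : ∀ t : ℝ, 0 ≤ S.dirForm u u γ * (t * t) + 2 * S.dirForm u v ζ * t
      + S.dirForm v v γ := by
    intro t
    have hp := (abs_le.1 (dom (t • u + v))).1
    have hm := (abs_le.1 (dom (t • u + -v))).2
    simp only [dirForm_add_left, dirForm_add_right, dirForm_smul_left, dirForm_smul_right,
      dirForm_neg_left, dirForm_neg_right] at hp hm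
    rw [S.dirForm_symm v u] at hp hm
    rw [S.dirForm_symm v u] at hp hm
    linarith
  have := discrim_le_zero key
  rw [discrim] at this
  linarith

end PluripotentialSetup
end

/-! ### Derivative and concavity of the energy -/

noncomputable section
namespace PluripotentialSetup

variable {X : Type*} [TopologicalSpace X] [CompactSpace X] [T2Space X]
  {Z : Type*} [AddCommGroup Z] [Module ℝ Z] [PartialOrder Z] [IsOrderedAddMonoid Z]
  [IsOrderedModule ℝ Z]

section

variable {n : ℕ} (S : PluripotentialSetup X Z n)

/-- The family with `i` entries `a` followed by entries `b`. -/
def mixed (n : ℕ) (a b : Z) (i : ℕ) : Fin n → Z := fun j => if (j : ℕ) < i then a else b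

theorem pairing_const (ω : Z) (φ : S.D) :
    S.pairing (fun _ => ω) (fun _ => φ) =
      ∑ i ∈ Finset.range (n + 1), S.integral φ (mixed n ω (ω + S.ddc φ) i) := by
  rw [pairing, Finset.sum_range]
  refine Finset.sum_congr rfl fun i _ => ?_
  rw [integral_apply]
  congr 2
  ext j
  have h : i.succAbove j < i ↔ (j : ℕ) < i := Fin.succAbove_lt_iff_castSucc_lt i j
  simp only [mixed, h]

/-- By symmetry of the product only the number of entries `a` matters; the transposition of the
slots i and j restores the standard order. -/
theorem integral_update_mixed (f : C(X, ℝ)) (a b : Z) (i : ℕ) (j : Fin n) (hj : i ≤ j) :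
    S.integral f (Function.update (mixed n a b i) j a) = S.integral f (mixed n a b (i + 1)) := by
  have hi : i < n := hj.trans_lt j.2
  rw [← S.integral_symm f (Equiv.swap ⟨i, hi⟩ j)]
  congr 1
  ext k
  by_cases h1 : k = ⟨i, hi⟩
  · subst h1; simp [mixed]
  · have h1' : (k : ℕ) ≠ i := fun h => h1 (Fin.ext h)
    by_cases h2 : k = j
    · subst h2
      have : ¬ (k : ℕ) < i + 1 := by omega
      rw [Equiv.swap_apply_right]
      by_cases h3 : (⟨i, hi⟩ : Fin n) = k
      · exact absurd h3.symm h1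
      · simp [Function.update_of_ne h3, mixed, this]
    · rw [Equiv.swap_apply_of_ne_of_ne h1 h2]
      have : (k : ℕ) < i ↔ (k : ℕ) < i + 1 := by omega
      simp [Function.update_of_ne h2, mixed, this]

theorem sum_ite_lt (n i : ℕ) (hi : i ≤ n) (c : ℝ) :
    ∑ j : Fin n, (if (j : ℕ) < i then 0 else c) = ((n : ℝ) - i) * c := by
  rw [Fin.sum_univ_eq_sum_range (fun j => if j < i then 0 else c) n, Finset.sum_ite]
  have : Finset.filter (fun j => ¬ j < i) (Finset.range n) = Finset.Ico i n := by
    ext j; simp; omega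
  rw [this]
  simp [Nat.cast_sub hi]

/-- Sums the derivatives of the terms of the energy: the i-th term has n - i varying entries, each
contributing a i - a (i + 1). The first k terms add up to (n + 1) a 0 - (n + 1 - k) a k. -/
theorem sum_weighted_telescope (n : ℕ) (a : ℕ → ℝ) :
    ∑ i ∈ Finset.range (n + 1), (a i + ((n : ℝ) - i) * (a i - a (i + 1))) = (n + 1) * a 0 := by
  have key : ∀ k : ℕ, ∑ i ∈ Finset.range k, (a i + ((n : ℝ) - i) * (a i - a (i + 1))) =
      (n + 1) * a 0 - (n + 1 - k) * a k := by
    intro k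
    induction k with
    | zero => simp
    | succ k ih => rw [Finset.sum_range_succ, ih]; push_cast; ring
  rw [key]; push_cast; ring

/-- The Monge-Ampère measure is the derivative of the energy. -/
theorem hasDerivAt_pairing (ω : Z) (ψ u : S.D) (t : ℝ) :
    HasDerivAt (fun t : ℝ => S.pairing (fun _ => ω) (fun _ => ψ + t • u))
      ((n + 1) * S.integral u (fun _ => ω + S.ddc (ψ + t • u))) t := by
  have hm : ∀ (i : ℕ) (t : ℝ), mixed n ω (ω + S.ddc (ψ + t • u)) i = fun j =>
      mixed n ω (ω + S.ddc ψ) i j + t • mixed n 0 (S.ddc u) i j := by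
    intro i t
    ext j
    by_cases h : (j : ℕ) < i
    · simp [mixed, h]
    · simp [mixed, h, add_assoc]
  have hterm : ∀ i ∈ Finset.range (n + 1), HasDerivAt
      (fun t : ℝ => S.integral (ψ + t • u : S.D) (mixed n ω (ω + S.ddc (ψ + t • u)) i))
      (S.integral u (mixed n ω (ω + S.ddc (ψ + t • u)) i) + ((n : ℝ) - i) *
        (S.integral u (mixed n ω (ω + S.ddc (ψ + t • u)) i) -
          S.integral u (mixed n ω (ω + S.ddc (ψ + t • u)) (i + 1)))) t := by
    intro i hi
    have hi' : i ≤ n := by simpa [Nat.lt_succ_iff] using hi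
    have h1 := (S.integral ψ).hasDerivAt_affine (mixed n ω (ω + S.ddc ψ) i)
      (mixed n 0 (S.ddc u) i) t
    have h2 := (S.integral u).hasDerivAt_affine (mixed n ω (ω + S.ddc ψ) i)
      (mixed n 0 (S.ddc u) i) t
    have h3 := h1.add ((hasDerivAt_id t).mul h2)
    have hfun : (fun t : ℝ => S.integral (ψ + t • u : S.D)
        (mixed n ω (ω + S.ddc (ψ + t • u)) i)) =
        (fun t => S.integral ψ (fun j => mixed n ω (ω + S.ddc ψ) i j
          + t • mixed n 0 (S.ddc u) i j) + id t * S.integral u (fun j =>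
            mixed n ω (ω + S.ddc ψ) i j + t • mixed n 0 (S.ddc u) i j)) := by
      ext t
      rw [hm, Submodule.coe_add, Submodule.coe_smul, integral_add, integral_smul]
      rfl
    rw [hfun]
    refine HasDerivAt.congr_deriv h3 ?_
    rw [← hm]
    -- Integration by parts turns ∫ (ψ + t u) ddᶜu into ∫ u ddᶜ(ψ + t u), and ddᶜ(ψ + t u) is the
    -- varying entry minus ω.
    have h4 : ∀ j : Fin n, S.integral ψ (Function.update (mixed n ω (ω + S.ddc (ψ + t • u)) i) j
        (mixed n 0 (S.ddc u) i j)) + t * S.integral u (Function.update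
          (mixed n ω (ω + S.ddc (ψ + t • u)) i) j (mixed n 0 (S.ddc u) i j)) =
        if (j : ℕ) < i then 0 else (S.integral u (mixed n ω (ω + S.ddc (ψ + t • u)) i) -
          S.integral u (mixed n ω (ω + S.ddc (ψ + t • u)) (i + 1))) := by
      intro j
      by_cases h : (j : ℕ) < i
      · simp [mixed, h]
      · have e : mixed n 0 (S.ddc u) i j = S.ddc u := by simp [mixed, h]
        rw [e, if_neg h, ← integral_smul, ← integral_add, ← Submodule.coe_smul,
          ← Submodule.coe_add, integral_ddc_symm, ← S.integral_update_mixed _ _ _ i j (not_lt.1 h)]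
        have e2 : S.ddc (ψ + t • u) = (ω + S.ddc (ψ + t • u)) - ω := by abel
        conv_lhs => rw [e2]
        have e3 : Function.update (mixed n ω (ω + S.ddc (ψ + t • u)) i) j (ω + S.ddc (ψ + t • u))
            = mixed n ω (ω + S.ddc (ψ + t • u)) i := by
          rw [Function.update_eq_self_iff]
          simp [mixed, h]
        rw [MultilinearMap.map_update_sub, ← e2, e3]
    rw [← sum_ite_lt n i hi', ← Finset.sum_congr rfl (fun j _ => h4 j), Finset.sum_add_distrib,
      Finset.mul_sum]
    simp only [id_eq]
    ring
  have H := HasDerivAt.fun_sum hterm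
  rw [sum_weighted_telescope n
    (fun i => S.integral u (mixed n ω (ω + S.ddc (ψ + t • u)) i))] at H
  have e0 : mixed n ω (ω + S.ddc (ψ + t • u)) 0 = fun _ => ω + S.ddc (ψ + t • u) := by
    ext j; simp [mixed]
  rw [e0] at H
  simpa only [pairing_const] using H

theorem vol_eq (ω : Z) : S.vol ω = S.integral 1 (fun _ => ω) := rfl

theorem vol_mul_mu {ω : Z} (hV : 0 < S.vol ω) (f : C(X, ℝ)) :
    S.vol ω * S.mu ω f = S.integral f (fun _ => ω) := by
  change S.vol ω * ((S.vol ω)⁻¹ * _) = _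
  rw [mul_inv_cancel_left₀ hV.ne']
  rfl

theorem vol_mul_MA {ω : Z} (hV : 0 < S.vol ω) (φ : S.D) (f : C(X, ℝ)) :
    S.vol ω * S.MA ω φ f = S.integral f (fun _ => ω + S.ddc φ) := by
  change S.vol ω * ((S.vol ω)⁻¹ * _) = _
  rw [mul_inv_cancel_left₀ hV.ne']
  rfl

end

variable {m : ℕ} (S : PluripotentialSetup X Z (m + 1))

/-- Convex combinations of `ω`-psh functions. -/
theorem psh_segment {ω : Z} {φ ψ : S.D} (hφ : φ ∈ S.psh ω) (hψ : ψ ∈ S.psh ω) {t : ℝ}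
    (h0 : 0 ≤ t) (h1 : t ≤ 1) : 0 ≤ ω + S.ddc (ψ + t • (φ - ψ)) := by
  have e : ω + S.ddc (ψ + t • (φ - ψ)) = t • (ω + S.ddc φ) + (1 - t) • (ω + S.ddc ψ) := by
    simp only [map_add, map_smul, map_sub]
    module
  rw [e]
  exact add_nonneg (smul_nonneg h0 hφ) (smul_nonneg (by linarith) hψ)

/-- Monotonicity of `t ↦ ∫ u (ω + t ddᶜ u)ⁿ`, with a quantitative gain. -/
theorem dirForm_le_integral_sub (u : S.D) (a b : Z) (ha : 0 ≤ a) (hb : 0 ≤ b) (c : ℝ) (hc : 0 ≤ c)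
    (hab : a - b = -(c • S.ddc u)) :
    c * S.dirForm u u (fun _ => a) ≤ S.integral u (fun _ => a) - S.integral u (fun _ => b) := by
  have hpos : ∀ (s : Finset (Fin (m + 1))) j, 0 ≤ s.piecewise (fun _ => a) (fun _ => b) j := by
    intro s j
    by_cases h : j ∈ s <;> simp [h, ha, hb]
  have step : ∀ (s : Finset (Fin (m + 1))) (j : Fin (m + 1)), j ∉ s →
      S.integral u ((insert j s).piecewise (fun _ => a) (fun _ => b)) -
        S.integral u (s.piecewise (fun _ => a) (fun _ => b)) =
      c * S.dirForm u u (j.removeNth (s.piecewise (fun _ => a) (fun _ => b))) := by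
    intro s j hj
    have e : S.integral u (s.piecewise (fun _ => a) (fun _ => b)) =
        S.integral u (Function.update (s.piecewise (fun _ => a) (fun _ => b)) j b) := by
      congr 1
      rw [Function.eq_update_iff]
      simp [hj]
    rw [e, Finset.piecewise_insert, ← MultilinearMap.map_update_sub, hab, ← neg_smul,
      MultilinearMap.map_update_smul, integral_update_ddc]
    simp
  have mono : ∀ s : Finset (Fin (m + 1)), S.integral u (fun _ => b) ≤
      S.integral u (s.piecewise (fun _ => a) (fun _ => b)) := by
    intro s
    induction s using Finset.induction_on with
    | empty => simp
    | insert j s hj ih =>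
      have h1 := step s j hj
      have h2 := mul_nonneg hc (S.dirForm_self_nonneg u
        (j.removeNth (s.piecewise (fun _ => a) (fun _ => b))) (fun i => hpos s _))
      linarith
  -- Slot 0 is replaced last, when all other entries are already `a`. Only this gain is kept; the
  -- others are nonnegative.
  have h1 := step (Finset.univ.erase 0) 0 (by simp)
  rw [Finset.insert_erase (Finset.mem_univ _), Finset.piecewise_univ] at h1
  have e : (0 : Fin (m + 1)).removeNth ((Finset.univ.erase 0).piecewise
      (fun _ => a) (fun _ => b)) = fun _ => a := by
    ext j
    simp [Fin.removeNth]
  rw [e] at h1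
  have h2 := mono (Finset.univ.erase 0)
  linarith

/-- The Dirichlet functional is the defect of the energy from its tangent. -/
theorem vol_mul_dirichlet {ω : Z} (hV : 0 < S.vol ω) (φ ψ : S.D) :
    ((m + 1 : ℕ) + 1 : ℝ) * (S.vol ω * S.dirichlet ω φ ψ) =
      S.pairing (fun _ => ω) (fun _ => φ) - S.pairing (fun _ => ω) (fun _ => ψ)
      - ((m + 1 : ℕ) + 1) * S.integral (φ - ψ : S.D) (fun _ => ω + S.ddc φ) := by
  have hm : ((m + 1 : ℕ) + 1 : ℝ) ≠ 0 := by positivity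
  have h := S.vol_mul_MA hV φ (ψ - φ : S.D)
  have e : ((ψ - φ : S.D) : C(X, ℝ)) = -((φ - ψ : S.D) : C(X, ℝ)) := by
    simp
  rw [dirichlet, mul_add, h, energy, energy]
  rw [e, integral_neg]
  field_simp
  ring

/-- The Dirichlet functional controls the Dirichlet form at the midpoint. -/
theorem dirForm_midpoint_le_dirichlet {ω : Z} (hV : 0 < S.vol ω) {φ ψ : S.D}
    (hφ : φ ∈ S.psh ω) (hψ : ψ ∈ S.psh ω) :
    S.dirForm (φ - ψ) (φ - ψ) (fun _ => ω + S.ddc ((1 / 2 : ℝ) • (φ + ψ))) ≤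
      8 * 2 ^ m * (S.vol ω * S.dirichlet ω φ ψ) := by
  set u := φ - ψ with hu
  set g : ℝ → ℝ := fun t => S.pairing (fun _ => ω) (fun _ => ψ + t • u) with hg
  set g' : ℝ → ℝ := fun t => ((m + 1 : ℕ) + 1) * S.integral u (fun _ => ω + S.ddc (ψ + t • u))
    with hg'
  have hder : ∀ t, HasDerivAt g (g' t) t := S.hasDerivAt_pairing ω ψ u
  have e1 : ψ + (1 : ℝ) • u = φ := by rw [hu]; module
  have e0 : ψ + (0 : ℝ) • u = ψ := by module
  have hJ : ((m + 1 : ℕ) + 1 : ℝ) * (S.vol ω * S.dirichlet ω φ ψ) = g 1 - g 0 - g' 1 := by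
    rw [S.vol_mul_dirichlet hV]
    simp only [hg, hg', e1, e0]
    rfl
  have hN : (0 : ℝ) < ((m + 1 : ℕ) + 1 : ℝ) := by positivity
  have hmono : ∀ t, 0 ≤ t → t ≤ 1 → ((m + 1 : ℕ) + 1 : ℝ) * ((1 - t) *
      S.dirForm u u (fun _ => ω + S.ddc (ψ + t • u))) ≤ g' t - g' 1 := by
    intro t h0 h1
    have := S.dirForm_le_integral_sub u (ω + S.ddc (ψ + t • u)) (ω + S.ddc (ψ + (1 : ℝ) • u))
      (S.psh_segment hφ hψ h0 h1) (S.psh_segment hφ hψ zero_le_one le_rfl) (1 - t) (by linarith)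
      (by simp only [map_add, map_smul]; module)
    calc _ ≤ _ := mul_le_mul_of_nonneg_left this hN.le
      _ = _ := by simp only [hg']; ring
  have hmono' : ∀ t, 0 ≤ t → t ≤ 1 → g' 1 ≤ g' t := by
    intro t h0 h1
    have h2 := S.dirForm_self_nonneg u (fun _ => ω + S.ddc (ψ + t • u))
      (fun _ => S.psh_segment hφ hψ h0 h1)
    have h3 := mul_nonneg hN.le (mul_nonneg (by linarith : 0 ≤ 1 - t) h2)
    linarith [hmono t h0 h1]
  have hcont : Continuous g := continuous_iff_continuousAt.2 fun t => (hder t).continuousAt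
  -- The outer intervals contribute nonnegatively to g 1 - g 0 - g' 1. The middle one has length
  -- 1/2, there 1 - t ≥ 1/4, and halving m entries costs 2⁻ᵐ: hence the factor 8 · 2ᵐ.
  obtain ⟨s, hs, hs'⟩ := exists_hasDerivAt_eq_slope g g' (by norm_num : (0 : ℝ) < 1 / 4)
    hcont.continuousOn fun t _ => hder t
  obtain ⟨t, ht, ht'⟩ := exists_hasDerivAt_eq_slope g g' (by norm_num : (1 / 4 : ℝ) < 3 / 4)
    hcont.continuousOn fun t _ => hder t
  obtain ⟨r, hr, hr'⟩ := exists_hasDerivAt_eq_slope g g' (by norm_num : (3 / 4 : ℝ) < 1)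
    hcont.continuousOn fun t _ => hder t
  have hs1 := hmono' s (by linarith [hs.1]) (by linarith [hs.2])
  have hr1 := hmono' r (by linarith [hr.1]) (by linarith [hr.2])
  have ht1 := hmono t (by linarith [ht.1]) (by linarith [ht.2])
  -- On [1/4, 3/4] both weights t and 1 - t are at least 1/4, so the form at t dominates half of the
  -- form at the midpoint.
  have hQ : S.dirForm u u (fun _ => (1 / 2 : ℝ) • (ω + S.ddc ((1 / 2 : ℝ) • (φ + ψ)))) ≤
      S.dirForm u u (fun _ => ω + S.ddc (ψ + t • u)) := by
    refine (S.dirForm u u).le_of_le (S.dirForm_self_nonneg u) _ _ (fun _ => ?_) (fun _ => ?_)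
    · refine smul_nonneg (by norm_num) ?_
      have := S.psh_segment hφ hψ (t := 1 / 2) (by norm_num) (by norm_num)
      convert this using 3
      module
    · rw [← sub_nonneg]
      have e : ω + S.ddc (ψ + t • u) - (1 / 2 : ℝ) • (ω + S.ddc ((1 / 2 : ℝ) • (φ + ψ))) =
          (t - 1 / 4) • (ω + S.ddc φ) + (3 / 4 - t) • (ω + S.ddc ψ) := by
        simp only [hu, map_add, map_smul, map_sub]
        module
      rw [e]
      exact add_nonneg (smul_nonneg (by linarith [ht.1]) hφ) (smul_nonneg (by linarith [ht.2]) hψ)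
  rw [MultilinearMap.map_smul_univ] at hQ
  simp only [Finset.prod_const, Finset.card_univ, Fintype.card_fin, smul_eq_mul] at hQ
  set Q := S.dirForm u u (fun _ => ω + S.ddc ((1 / 2 : ℝ) • (φ + ψ)))
  have hQt : 0 ≤ S.dirForm u u (fun _ => ω + S.ddc (ψ + t • u)) :=
    S.dirForm_self_nonneg u _ fun _ =>
      S.psh_segment hφ hψ (by linarith [ht.1]) (by linarith [ht.2])
  have h5 : (1 / 4) * ((1 / 2 : ℝ) ^ m * Q) ≤
      (1 - t) * S.dirForm u u (fun _ => ω + S.ddc (ψ + t • u)) :=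
    (mul_le_mul_of_nonneg_left hQ (by norm_num)).trans
      (mul_le_mul_of_nonneg_right (by linarith [ht.2]) hQt)
  have h6 := mul_le_mul_of_nonneg_left h5 hN.le
  have h7 : ((m + 1 : ℕ) + 1 : ℝ) * ((1 / 8) * ((1 / 2 : ℝ) ^ m * Q)) ≤
      ((m + 1 : ℕ) + 1 : ℝ) * (S.vol ω * S.dirichlet ω φ ψ) := by
    rw [hJ]
    have a1 : g (1 / 4) - g 0 = g' s * (1 / 4) := by rw [hs']; ring
    have a2 : g (3 / 4) - g (1 / 4) = g' t * (1 / 2) := by rw [ht']; ring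
    have a3 : g 1 - g (3 / 4) = g' r * (1 / 4) := by rw [hr']; ring
    linarith
  have h8 := le_of_mul_le_mul_left h7 hN
  have h9 : (2 : ℝ) ^ m * (1 / 2) ^ m = 1 := by rw [← mul_pow]; norm_num
  calc Q = 8 * 2 ^ m * (1 / 8 * ((1 / 2) ^ m * Q)) := by linear_combination -Q * h9
    _ ≤ _ := mul_le_mul_of_nonneg_left h8 (by positivity)

theorem dirichlet_nonneg {ω : Z} (hV : 0 < S.vol ω) {φ ψ : S.D}
    (hφ : φ ∈ S.psh ω) (hψ : ψ ∈ S.psh ω) : 0 ≤ S.dirichlet ω φ ψ := by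
  have h := S.dirForm_midpoint_le_dirichlet hV hφ hψ
  have h0 : 0 ≤ S.dirForm (φ - ψ) (φ - ψ) (fun _ => ω + S.ddc ((1 / 2 : ℝ) • (φ + ψ))) :=
    S.dirForm_self_nonneg _ _ fun _ => by
      have := S.psh_segment hφ hψ (t := 1 / 2) (by norm_num) (by norm_num)
      convert this using 3
      module
  have h1 := h0.trans h
  have h2 : 0 ≤ S.vol ω * S.dirichlet ω φ ψ := nonneg_of_mul_nonneg_right h1 (by positivity)
  exact nonneg_of_mul_nonneg_right h2 hV

end PluripotentialSetup
end

/-! ### The positive cone, the volume and the submean property -/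

noncomputable section
namespace PluripotentialSetup

variable {X : Type*} [TopologicalSpace X] [CompactSpace X] [T2Space X]
  {Z : Type*} [AddCommGroup Z] [Module ℝ Z] [PartialOrder Z] [IsOrderedAddMonoid Z]
  [IsOrderedModule ℝ Z] {n : ℕ} (S : PluripotentialSetup X Z n)

theorem continuous_finestTopology {V : Type*} [AddCommGroup V] [Module ℝ V] (k : ℕ)
    (f : (Fin k → ℝ) →ₗ[ℝ] V) : @Continuous _ _ _ (finestTopology V) f := by
  rw [continuous_iff_coinduced_le]
  exact le_iSup_of_le k (le_iSup (fun f : (Fin k → ℝ) →ₗ[ℝ] V =>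
    TopologicalSpace.coinduced f inferInstance) f)

/-- The linear map `x ↦ x₀ a + x₁ b`. -/
def planeMap {V : Type*} [AddCommGroup V] [Module ℝ V] (a b : V) : (Fin 2 → ℝ) →ₗ[ℝ] V :=
  (LinearMap.proj 0).smulRight a + (LinearMap.proj 1).smulRight b

theorem planeMap_apply {V : Type*} [AddCommGroup V] [Module ℝ V] (a b : V) (x : Fin 2 → ℝ) :
    planeMap a b x = x 0 • a + x 1 • b := rfl

/-- A form of positive class dominates a multiple of every form, up to an exact form. -/
theorem exists_smul_le_of_cls_mem_Pos {ω : Z} (hω : S.cls ω ∈ S.Pos) (θ : Z) :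
    ∃ t : ℝ, 0 < t ∧ ∃ ρ : S.D, t • θ ≤ ω + S.ddc ρ := by
  -- Openness in the finest topology is only needed on the plane of [ω] and [θ]: the class [ω] - s
  -- [θ] stays in the cone for small s.
  let U : Set (Fin 2 → ℝ) := planeMap (S.cls ω) (S.cls θ) ⁻¹' S.Pos
  have hU : IsOpen U := by
    let := finestTopology S.BottChern
    exact isOpen_interior.preimage (continuous_finestTopology 2 _)
  have hc : Continuous fun s : ℝ => (![1, -s] : Fin 2 → ℝ) := by
    refine continuous_pi fun i => ?_
    fin_cases i
    · exact continuous_const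
    · exact continuous_neg
  have h0 : (0 : ℝ) ∈ (fun s : ℝ => (![1, -s] : Fin 2 → ℝ)) ⁻¹' U := by
    change planeMap _ _ _ ∈ S.Pos
    rw [planeMap_apply]
    simpa using hω
  obtain ⟨ε, hε, hball⟩ := Metric.isOpen_iff.1 (hU.preimage hc) 0 h0
  have h1 : ε / 2 ∈ (fun s : ℝ => (![1, -s] : Fin 2 → ℝ)) ⁻¹' U := by
    apply hball
    rw [Metric.mem_ball, dist_zero_right, Real.norm_eq_abs, abs_of_pos (by linarith)]
    linarith
  have h2 : planeMap (S.cls ω) (S.cls θ) ![1, -(ε / 2)] ∈ S.cls '' {θ : Z | 0 ≤ θ} := by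
    let := finestTopology S.BottChern
    exact interior_subset h1
  obtain ⟨η, hη, he⟩ := h2
  rw [planeMap_apply] at he
  have h3 : η - (ω - (ε / 2) • θ) ∈ LinearMap.range S.ddc := by
    rw [← Submodule.Quotient.mk_eq_zero]
    have : S.cls η - (S.cls ω - (ε / 2) • S.cls θ) = 0 := by
      rw [he]
      simp [sub_eq_add_neg]
    exact this
  obtain ⟨ρ, hρ⟩ := h3
  refine ⟨ε / 2, by linarith, ρ, ?_⟩
  rw [hρ, ← sub_nonneg]
  have : ω + (η - (ω - (ε / 2) • θ)) - (ε / 2) • θ = η := by abel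
  rw [this]
  exact hη

theorem abs_integral_le (f : C(X, ℝ)) (θ : Fin n → Z) (hθ : ∀ j, 0 ≤ θ j) :
    |S.integral f θ| ≤ ‖f‖ * S.integral 1 θ := by
  have h1 : f ≤ ‖f‖ • (1 : C(X, ℝ)) := fun x => by
    simpa using (le_abs_self _).trans (f.norm_coe_le_norm x)
  have h2 : -(‖f‖ • (1 : C(X, ℝ))) ≤ f := fun x => by
    simpa using neg_le_of_abs_le (f.norm_coe_le_norm x)
  have h3 := S.integral_mono h1 θ hθ
  have h4 := S.integral_mono h2 θ hθ
  rw [integral_neg, integral_smul] at h4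
  rw [integral_smul] at h3
  exact abs_le.2 ⟨h4, h3⟩

theorem exists_abs_le (S : PluripotentialSetup X Z n) (ζ : Z) : ∃ γ : Z, 0 ≤ γ ∧ ζ ≤ γ ∧ -ζ ≤ γ := by
  have h : ζ ∈ Submodule.span ℝ {θ : Z | 0 ≤ θ} := by rw [S.span_nonneg]; trivial
  induction h using Submodule.span_induction with
  | mem x hx => exact ⟨x, hx, le_rfl, (neg_nonpos.2 hx).trans hx⟩
  | zero => exact ⟨0, le_rfl, le_rfl, by simp⟩
  | add x y _ _ hx hy =>
    obtain ⟨a, ha, ha1, ha2⟩ := hx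
    obtain ⟨b, hb, hb1, hb2⟩ := hy
    refine ⟨a + b, add_nonneg ha hb, add_le_add ha1 hb1, ?_⟩
    rw [neg_add]
    exact add_le_add ha2 hb2
  | smul c x _ hx =>
    obtain ⟨a, ha, ha1, ha2⟩ := hx
    rcases le_total 0 c with hc | hc
    · refine ⟨c • a, smul_nonneg hc ha, smul_le_smul_of_nonneg_left ha1 hc, ?_⟩
      rw [← smul_neg]
      exact smul_le_smul_of_nonneg_left ha2 hc
    · have hc' : 0 ≤ -c := by linarith
      refine ⟨(-c) • a, smul_nonneg hc' ha, ?_, ?_⟩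
      · have := smul_le_smul_of_nonneg_left ha2 hc'
        simpa using this
      · have := smul_le_smul_of_nonneg_left ha1 hc'
        simpa using this

/-- Up to exact forms, ω dominates a positive multiple of every form, and exact forms do not change
masses. Zero volume would thus make every product vanish, against `wedge_ne_zero`. -/
theorem vol_pos {ω : Z} (hω0 : 0 ≤ ω) (hω : S.cls ω ∈ S.Pos) : 0 < S.vol ω := by
  have hnn : 0 ≤ S.vol ω :=
    S.integral_nonneg (by intro x; simp) (fun _ => ω) fun _ => hω0
  refine lt_of_le_of_ne hnn fun h0 => S.wedge_ne_zero ?_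
  have hpos : ∀ (ζ : Fin n → Z) (f : C(X, ℝ)), 0 ≤ f → S.integral f ζ = 0 := by
    intro ζ f hf
    choose γ hγ h1 h2 using fun j => S.exists_abs_le (ζ j)
    choose t ht ρ hρ using fun j => S.exists_smul_le_of_cls_mem_Pos hω (γ j)
    have e1 := (S.integral f).abs_le_of_abs_le (fun ζ h => S.integral_nonneg hf ζ h) ζ γ h1 h2
    have e2 : S.integral f (fun j => t j • γ j) ≤ S.integral f (fun j => ω + S.ddc (ρ j)) :=
      (S.integral f).le_of_le (fun ζ h => S.integral_nonneg hf ζ h) _ _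
        (fun j => smul_nonneg (ht j).le (hγ j)) hρ
    have e3 := (le_abs_self _).trans (S.abs_integral_le f (fun j => ω + S.ddc (ρ j))
      fun j => (smul_nonneg (ht j).le (hγ j)).trans (hρ j))
    rw [S.integral_one_add_ddc (fun _ => ω) ρ, ← vol_eq, ← h0, mul_zero] at e3
    rw [MultilinearMap.map_smul_univ, smul_eq_mul] at e2
    have e4 : S.integral f γ ≤ 0 := by
      have := e2.trans e3
      exact nonpos_of_mul_nonpos_right this (Finset.prod_pos fun j _ => ht j)
    exact abs_eq_zero.1 (le_antisymm (e1.trans e4) (abs_nonneg _))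
  ext ζ f
  have h1 := hpos ζ (f + ‖f‖ • (1 : C(X, ℝ))) (fun x => by
    have := neg_le_of_abs_le (f.norm_coe_le_norm x)
    simp
    linarith)
  have h2 := hpos ζ (‖f‖ • (1 : C(X, ℝ))) (fun x => by simp)
  rw [integral_add, h2, add_zero] at h1
  simpa [integral_apply] using h1

theorem nonempty_of_vol_pos {ω : Z} (hV : 0 < S.vol ω) : Nonempty X := by
  by_contra h
  rw [not_nonempty_iff] at h
  have : (1 : C(X, ℝ)) = 0 := by ext x; exact h.elim x
  rw [vol, this, map_zero] at hV
  exact lt_irrefl _ hV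

theorem mu_one {ω : Z} (hV : 0 < S.vol ω) : S.mu ω 1 = 1 := by
  have := S.vol_mul_mu hV 1
  rw [← vol_eq] at this
  exact mul_left_cancel₀ hV.ne' (by rw [this, mul_one])

theorem mu_nonneg {ω : Z} (hω : 0 ≤ ω) (hV : 0 < S.vol ω) {f : C(X, ℝ)} (hf : 0 ≤ f) :
    0 ≤ S.mu ω f := by
  have h := S.integral_nonneg hf (fun _ => ω) fun _ => hω
  rw [← S.vol_mul_mu hV] at h
  exact nonneg_of_mul_nonneg_right h hV

theorem mu_mono {ω : Z} (hω : 0 ≤ ω) (hV : 0 < S.vol ω) {f g : C(X, ℝ)} (h : f ≤ g) :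
    S.mu ω f ≤ S.mu ω g := by
  have := S.mu_nonneg hω hV (sub_nonneg.2 h)
  rw [map_sub] at this
  linarith

theorem abs_mu_le {ω : Z} (hω : 0 ≤ ω) (hV : 0 < S.vol ω) (f : C(X, ℝ)) :
    |S.mu ω f| ≤ ‖f‖ := by
  have h := S.abs_integral_le f (fun _ => ω) fun _ => hω
  rw [← vol_eq, ← S.vol_mul_mu hV, abs_mul, abs_of_pos hV, mul_comm] at h
  exact le_of_mul_le_mul_right h hV

/-- The submean inequality with constant `T`. -/
def SubmeanBound (ω : Z) (T : ℝ) : Prop :=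
  ∀ φ ∈ S.psh ω, ∀ x : X, (φ : C(X, ℝ)) x ≤ S.mu ω φ + T

theorem bddAbove_range_coe {Y : Type*} [TopologicalSpace Y] [CompactSpace Y] (f : C(Y, ℝ)) : BddAbove (Set.range f) :=
  (isCompact_range f.continuous).bddAbove

theorem submeanBound_submeanConst {ω : Z} (h : BddAbove (S.submeanSet ω)) :
    S.SubmeanBound ω (S.submeanConst ω) := by
  intro φ hφ x
  have h1 := le_csSup h ⟨φ, hφ, rfl⟩
  have h2 := le_ciSup (bddAbove_range_coe (φ : C(X, ℝ))) x
  rw [submeanConst]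
  linarith

theorem zero_mem_psh {ω : Z} (hω : 0 ≤ ω) : (0 : S.D) ∈ S.psh ω := by
  change 0 ≤ ω + S.ddc 0
  simpa using hω

theorem SubmeanBound.bddAbove [Nonempty X] {S : PluripotentialSetup X Z n} {ω : Z} {T : ℝ}
    (h : S.SubmeanBound ω T) : BddAbove (S.submeanSet ω) := by
  refine ⟨T, ?_⟩
  rintro _ ⟨φ, hφ, rfl⟩
  have := ciSup_le (h φ hφ)
  linarith

theorem submeanBound_nonneg [Nonempty X] {ω : Z} {T : ℝ} (hω : 0 ≤ ω) (h : S.SubmeanBound ω T) :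
    0 ≤ T := by
  have := h 0 (S.zero_mem_psh hω) (Classical.arbitrary X)
  simpa using this

/-- The submean property does not depend on the form of positive class. -/
theorem SubmeanBound.transfer {S : PluripotentialSetup X Z n} {ω ω' : Z} (hω0 : 0 ≤ ω)
    (hω : S.cls ω ∈ S.Pos) (hω0' : 0 ≤ ω') (hω' : S.cls ω' ∈ S.Pos) {T' : ℝ}
    (h : S.SubmeanBound ω' T') : ∃ T, S.SubmeanBound ω T := by
  have hV := S.vol_pos hω0 hω
  have hV' := S.vol_pos hω0' hω'
  have := S.nonempty_of_vol_pos hV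
  -- For φ0 = φ - max φ the function t φ0 + ρ is ω'-psh, so ω' bounds ∫ φ0 ω'ⁿ from below. Passing
  -- to (ω' + ddᶜρ)ⁿ costs n c', and since φ0 ≤ 0 and t ω ≤ ω' + ddᶜρ, the bound descends to tⁿ ∫ φ0
  -- ωⁿ.
  obtain ⟨t, ht, ρ, hρ⟩ := S.exists_smul_le_of_cls_mem_Pos hω' ω
  have hρ0 : 0 ≤ ω' + S.ddc ρ := (smul_nonneg ht.le hω0).trans hρ
  set R := ‖(ρ : C(X, ℝ))‖ with hR
  set c := (2 * R + T') / t with hc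
  set d : Fin n → ℝ := fun j => S.integral 1 (Function.update (fun _ => ω') j ω) with hd
  have hd0 : ∀ j, 0 ≤ d j := fun j => S.integral_nonneg (by intro x; simp) _ (by
    intro i
    by_cases hi : i = j
    · subst hi; simpa using hω0
    · simpa [hi] using hω0')
  set c' := 2 * R * ∑ j, d j with hc'
  refine ⟨(S.vol ω' * c + n * c') / (t ^ n * S.vol ω), fun φ hφ x => ?_⟩
  obtain ⟨x₀, -, hx₀⟩ := isCompact_univ.exists_isMaxOn Set.univ_nonempty
    (φ : C(X, ℝ)).continuous.continuousOn
  set M := (φ : C(X, ℝ)) x₀ with hM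
  have hmax : ∀ x, (φ : C(X, ℝ)) x ≤ M := fun x => hx₀ (Set.mem_univ x)
  set φ0 : S.D := φ - S.constD M with hφ0
  have hφ0x : ∀ x, (φ0 : C(X, ℝ)) x = (φ : C(X, ℝ)) x - M := fun x => rfl
  have hddc : S.ddc φ0 = S.ddc φ := by rw [hφ0, map_sub, ddc_constD, sub_zero]
  have hmuφ0 : S.mu ω φ0 = S.mu ω φ - M := by
    rw [hφ0, Submodule.coe_sub, map_sub, coe_constD, map_smul, S.mu_one hV]
    simp
  have hφ0nonpos : (φ0 : C(X, ℝ)) ≤ 0 := fun x => by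
    change (φ : C(X, ℝ)) x - M ≤ 0
    linarith [hmax x]
  have hpsh' : t • φ0 + ρ ∈ S.psh ω' := by
    change 0 ≤ ω' + S.ddc (t • φ0 + ρ)
    rw [map_add, map_smul, hddc]
    have e : ω' + (t • S.ddc φ + S.ddc ρ) =
        t • (ω + S.ddc φ) + ((ω' + S.ddc ρ) - t • ω) := by module
    rw [e]
    exact add_nonneg (smul_nonneg ht.le hφ) (sub_nonneg.2 hρ)
  have h1 := h _ hpsh' x₀
  have h2 : ((t • φ0 + ρ : S.D) : C(X, ℝ)) x₀ = (ρ : C(X, ℝ)) x₀ := by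
    change t * (φ0 : C(X, ℝ)) x₀ + (ρ : C(X, ℝ)) x₀ = _
    rw [hφ0x, ← hM, sub_self, mul_zero, zero_add]
  have h3 : -R ≤ (ρ : C(X, ℝ)) x₀ := neg_le_of_abs_le ((ρ : C(X, ℝ)).norm_coe_le_norm x₀)
  have h4 := (abs_le.1 (S.abs_mu_le hω0' hV' (ρ : C(X, ℝ)))).2
  rw [h2, Submodule.coe_add, Submodule.coe_smul, map_add, map_smul, smul_eq_mul] at h1
  have h5 : -c ≤ S.mu ω' φ0 := by
    rw [hc, ← neg_div, div_le_iff₀ ht]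
    linarith
  have hR0 : 0 ≤ R := norm_nonneg _
  -- After integration by parts the integrand is ρ, bounded by R, against a difference of two
  -- positive measures, both of mass d j, independent of φ.
  have h6 := (S.integral φ0).abs_sub_le_of_update (fun _ => ω' + S.ddc ρ) (fun _ => ω') c' (by
    intro s j hj
    rw [add_sub_cancel_left, integral_ddc_symm]
    have e : S.ddc φ0 = (ω + S.ddc φ0) - ω := by abel
    rw [e, MultilinearMap.map_update_sub]
    have hnn : ∀ (η : Z), 0 ≤ η → ∀ i, 0 ≤ (Function.update
        (s.piecewise (fun _ => ω' + S.ddc ρ) (fun _ => ω')) j η) i := by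
      intro η hη i
      by_cases hi : i = j
      · subst hi; simpa using hη
      · by_cases his : i ∈ s
        · simpa [hi, his] using hρ0
        · simpa [hi, his] using hω0'
    have hmass : ∀ (ψ : S.D), S.integral 1 (Function.update
        (s.piecewise (fun _ => ω' + S.ddc ρ) (fun _ => ω')) j (ω + S.ddc ψ)) = d j := by
      intro ψ
      simp only [hd]
      rw [← S.integral_one_add_ddc (Function.update (fun _ => ω') j ω)
        (Function.update (s.piecewise (fun _ => ρ) (fun _ => 0)) j ψ)]
      congr 1
      ext i
      by_cases hi : i = j
      · subst hi; simp
      · by_cases his : i ∈ s <;> simp [hi, his]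
    have hdj : d j ≤ ∑ j, d j := Finset.single_le_sum (fun i _ => hd0 i) (Finset.mem_univ j)
    have a1 := S.abs_integral_le ρ _ (hnn (ω + S.ddc φ0) (by rw [hddc]; exact hφ))
    have a2 := S.abs_integral_le ρ _ (hnn ω hω0)
    have a3 := hmass 0
    rw [map_zero, add_zero] at a3
    rw [hmass] at a1
    rw [a3] at a2
    have a4 := mul_le_mul_of_nonneg_left hdj hR0
    refine (abs_sub _ _).trans ?_
    rw [hc']
    linarith)
  have h7 : S.integral φ0 (fun _ => ω' + S.ddc ρ) ≤ S.integral φ0 (fun _ => t • ω) := by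
    have := (S.integral (-(φ0 : C(X, ℝ)))).le_of_le
      (fun ζ h => S.integral_nonneg (neg_nonneg.2 hφ0nonpos) ζ h) (fun _ => t • ω)
      (fun _ => ω' + S.ddc ρ) (fun _ => smul_nonneg ht.le hω0) (fun _ => hρ)
    rw [integral_neg, integral_neg] at this
    linarith
  rw [MultilinearMap.map_smul_univ, ← S.vol_mul_mu hV] at h7
  rw [← S.vol_mul_mu hV'] at h6
  simp only [Finset.prod_const, Finset.card_univ, Fintype.card_fin, smul_eq_mul] at h7
  have h8 := (abs_le.1 h6).1
  have h9 := mul_le_mul_of_nonneg_left h5 hV'.le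
  have hpos : 0 < t ^ n * S.vol ω := by positivity
  have h10 : -((S.vol ω' * c + n * c') / (t ^ n * S.vol ω)) ≤ S.mu ω φ0 := by
    rw [← neg_div, div_le_iff₀ hpos]
    linarith
  have := hmax x
  linarith

theorem SubmeanProperty.bddAbove {S : PluripotentialSetup X Z n} (h : S.SubmeanProperty) {ω : Z}
    (hω0 : 0 ≤ ω) (hω : S.cls ω ∈ S.Pos) : BddAbove (S.submeanSet ω) := by
  obtain ⟨ω', h0, h1, h2⟩ := h
  obtain ⟨T, hT⟩ := (S.submeanBound_submeanConst h2).transfer hω0 hω h0 h1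
  have := S.nonempty_of_vol_pos (S.vol_pos hω0 hω)
  exact hT.bddAbove

end PluripotentialSetup
end

/-! ### A priori bounds in terms of the energy -/

noncomputable section
namespace PluripotentialSetup

variable {X : Type*} [TopologicalSpace X] [CompactSpace X] [T2Space X]
  {Z : Type*} [AddCommGroup Z] [Module ℝ Z] [PartialOrder Z] [IsOrderedAddMonoid Z]
  [IsOrderedModule ℝ Z]

section

variable {n : ℕ} (S : PluripotentialSetup X Z n)

theorem energy_zero (ω : Z) : S.energy ω 0 = 0 := by
  have : ∀ θ : Fin n → Z, S.integral ((0 : S.D) : C(X, ℝ)) θ = 0 := fun θ => map_zero (S.wedge θ)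
  rw [energy, pairing_const, Finset.sum_eq_zero fun _ _ => this _, zero_div]

theorem MA_zero (ω : Z) : S.MA ω 0 = S.mu ω := by
  simp [MA, mu]

theorem dirichlet_zero_left (ω : Z) (ψ : S.D) :
    S.dirichlet ω 0 ψ = S.mu ω ψ - S.energy ω ψ := by
  rw [dirichlet, energy_zero, MA_zero, sub_zero]
  ring

theorem energy_add_constD {ω : Z} (hV : 0 < S.vol ω) (ψ : S.D) (c : ℝ) :
    S.energy ω (ψ + S.constD c) = S.energy ω ψ + c := by
  have hN : (n + 1 : ℝ) ≠ 0 := by positivity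
  have h : S.pairing (fun _ => ω) (fun _ => ψ + S.constD c) =
      S.pairing (fun _ => ω) (fun _ => ψ) + (n + 1) * (c * S.vol ω) := by
    have hmass : ∀ i, S.integral 1 (mixed n ω (ω + S.ddc ψ) i) = S.vol ω := by
      intro i
      rw [vol_eq, ← S.integral_one_add_ddc (fun _ => ω) (fun j => if (j : ℕ) < i then 0 else ψ)]
      congr 1
      ext j
      by_cases h : (j : ℕ) < i <;> simp [mixed, h]
    rw [pairing_const, pairing_const, map_add, ddc_constD, add_zero]
    simp only [Submodule.coe_add, integral_add, coe_constD, integral_smul, hmass,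
      Finset.sum_add_distrib]
    simp
  rw [energy, energy, h, add_div, mul_div_mul_left _ _ hN, mul_div_assoc, div_self hV.ne', mul_one]

/-- The function `ψ - ∫ ψ μ_ω - T`, which is nonpositive when `T` is a submean constant. -/
def normalized (ω : Z) (T : ℝ) (ψ : S.D) : S.D := ψ + S.constD (-(S.mu ω ψ + T))

theorem normalized_apply (ω : Z) (T : ℝ) (ψ : S.D) (x : X) :
    (S.normalized ω T ψ : C(X, ℝ)) x = (ψ : C(X, ℝ)) x - S.mu ω ψ - T := by
  change (ψ : C(X, ℝ)) x + -(S.mu ω ψ + T) = _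
  ring

theorem ddc_normalized (ω : Z) (T : ℝ) (ψ : S.D) : S.ddc (S.normalized ω T ψ) = S.ddc ψ := by
  rw [normalized, map_add, ddc_constD, add_zero]

/-- The `ω`-psh functions with `J_ω(0, ψ) + T ≤ K`. -/
def EnergyBounded (ω : Z) (T K : ℝ) (ψ : S.D) : Prop :=
  ψ ∈ S.psh ω ∧ S.dirichlet ω 0 ψ + T ≤ K

theorem EnergyBounded.mono {S : PluripotentialSetup X Z n} {ω : Z} {T K L : ℝ} {ψ : S.D}
    (h : S.EnergyBounded ω T K ψ) (hKL : K ≤ L) : S.EnergyBounded ω T L ψ := ⟨h.1, h.2.trans hKL⟩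

theorem EnergyBounded.neg_le_energy {S : PluripotentialSetup X Z n} {ω : Z} {T K : ℝ} {ψ : S.D}
    (hV : 0 < S.vol ω) (h : S.EnergyBounded ω T K ψ) :
    -K ≤ S.energy ω (S.normalized ω T ψ) := by
  have := h.2
  rw [dirichlet_zero_left] at this
  rw [normalized, S.energy_add_constD hV]
  linarith

theorem SubmeanBound.normalized_nonpos {S : PluripotentialSetup X Z n} {ω : Z} {T : ℝ}
    (h : S.SubmeanBound ω T) {ψ : S.D} (hψ : ψ ∈ S.psh ω) :
    (S.normalized ω T ψ : C(X, ℝ)) ≤ 0 := fun x => by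
  have h1 := h ψ hψ x
  have h2 := S.normalized_apply ω T ψ x
  change (S.normalized ω T ψ : C(X, ℝ)) x ≤ 0
  linarith

end

variable {m : ℕ} (S : PluripotentialSetup X Z (m + 1))

/-- Concavity of the energy. -/
theorem energy_le_add_MA {ω : Z} (hV : 0 < S.vol ω) {φ ψ : S.D}
    (hφ : φ ∈ S.psh ω) (hψ : ψ ∈ S.psh ω) :
    S.energy ω ψ ≤ S.energy ω φ + S.MA ω φ ((ψ - φ : S.D) : C(X, ℝ)) := by
  have := S.dirichlet_nonneg hV hφ hψ
  rw [dirichlet] at this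
  linarith

/-- Average of `m + 2` functions. -/
def average (ψ : Fin (m + 2) → S.D) : S.D := ((m + 2 : ℝ)⁻¹) • ∑ i, ψ i

theorem add_ddc_average (ω : Z) (ψ : Fin (m + 2) → S.D) :
    ω + S.ddc (S.average ψ) = ((m + 2 : ℝ)⁻¹) • ∑ i, (ω + S.ddc (ψ i)) := by
  have hN : (m + 2 : ℝ) ≠ 0 := by positivity
  rw [average, map_smul, map_sum, Finset.sum_add_distrib, smul_add]
  congr 1
  simp only [Finset.sum_const, Finset.card_univ, Fintype.card_fin]
  rw [← Nat.cast_smul_eq_nsmul ℝ, smul_smul]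
  push_cast
  rw [inv_mul_cancel₀ hN, one_smul]

theorem smul_le_add_ddc_average {ω : Z} {ψ : Fin (m + 2) → S.D} (hψ : ∀ i, ψ i ∈ S.psh ω)
    (i : Fin (m + 2)) :
    ((m + 2 : ℝ)⁻¹) • (ω + S.ddc (ψ i)) ≤ ω + S.ddc (S.average ψ) := by
  rw [add_ddc_average]
  exact smul_le_smul_of_nonneg_left
    (Finset.single_le_sum (f := fun i => ω + S.ddc (ψ i)) (fun i _ => hψ i) (Finset.mem_univ i))
    (by positivity)

/-- Jensen's inequality: the tangent inequalities at the average are summed, and their linear terms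
cancel. -/
theorem le_energy_average {ω : Z} (hV : 0 < S.vol ω) {ψ : Fin (m + 2) → S.D}
    (hψ : ∀ i, ψ i ∈ S.psh ω) {c : ℝ} (hc : ∀ i, c ≤ S.energy ω (ψ i)) :
    c ≤ S.energy ω (S.average ψ) := by
  have hN : (0 : ℝ) < (m + 2 : ℝ) := by positivity
  have hχ : S.average ψ ∈ S.psh ω :=
    (smul_nonneg (by positivity) (hψ 0)).trans (S.smul_le_add_ddc_average hψ 0)
  have h1 : ∑ _i : Fin (m + 2), c ≤ ∑ i, (S.energy ω (S.average ψ) +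
      S.MA ω (S.average ψ) ((ψ i - S.average ψ : S.D) : C(X, ℝ))) :=
    Finset.sum_le_sum fun i _ => (hc i).trans (S.energy_le_add_MA hV hχ (hψ i))
  have h2 : ∑ i, (ψ i - S.average ψ) = 0 := by
    rw [Finset.sum_sub_distrib, sub_eq_zero]
    simp only [Finset.sum_const, Finset.card_univ, Fintype.card_fin]
    rw [← Nat.cast_smul_eq_nsmul ℝ, average, smul_smul]
    push_cast
    rw [mul_inv_cancel₀ hN.ne', one_smul]
  have h3 : ∑ i, S.MA ω (S.average ψ) ((ψ i - S.average ψ : S.D) : C(X, ℝ)) = 0 := by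
    rw [← map_sum, ← AddSubmonoidClass.coe_finsetSum, h2]
    simp
  rw [Finset.sum_add_distrib, h3] at h1
  simp only [Finset.sum_const, Finset.card_univ, Fintype.card_fin, nsmul_eq_mul, add_zero] at h1
  push_cast at h1
  exact le_of_mul_le_mul_left h1 hN

/-- Mixed Monge-Ampère integrals are controlled by the energy. -/
theorem integral_neg_normalized_le {ω : Z} (hω : 0 ≤ ω) (hV : 0 < S.vol ω) {T K : ℝ}
    (hT : S.SubmeanBound ω T) {φ : S.D} (hφ : S.EnergyBounded ω T K φ)
    {ψ : Fin (m + 1) → S.D} (hψ : ∀ j, S.EnergyBounded ω T K (ψ j)) :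
    S.integral (-(S.normalized ω T φ : C(X, ℝ))) (fun j => ω + S.ddc (ψ j)) ≤
      (m + 2) ^ (m + 3) * (S.vol ω * K) := by
  have hN : (0 : ℝ) < (m + 2 : ℝ) := by positivity
  -- The average χ of the normalized functions satisfies χ ≤ Φ 0 / (m + 2), and ω_χ dominates each
  -- ω_ψ divided by m + 2. One function and m + 1 entries cost (m + 2)^(m + 2); the energy of χ
  -- gives one more factor.
  set Ψ : Fin (m + 2) → S.D := Fin.cons φ ψ with hΨ
  have hΨb : ∀ i, S.EnergyBounded ω T K (Ψ i) := by
    intro i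
    refine Fin.cases ?_ (fun j => ?_) i
    · simpa [hΨ] using hφ
    · simpa [hΨ] using hψ j
  set Φ : Fin (m + 2) → S.D := fun i => S.normalized ω T (Ψ i) with hΦ
  have hΦp : ∀ i, Φ i ∈ S.psh ω := fun i => by
    change 0 ≤ ω + S.ddc _
    rw [ddc_normalized]
    exact (hΨb i).1
  have hΦn : ∀ i, (Φ i : C(X, ℝ)) ≤ 0 := fun i => hT.normalized_nonpos (hΨb i).1
  have hE := S.le_energy_average hV hΦp fun i => (hΨb i).neg_le_energy hV
  set χ := S.average Φ with hχ
  have hχp : 0 ≤ ω + S.ddc χ :=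
    (smul_nonneg (by positivity) (hΦp 0)).trans (S.smul_le_add_ddc_average hΦp 0)
  have hχle : (χ : C(X, ℝ)) ≤ (m + 2 : ℝ)⁻¹ • (Φ 0 : C(X, ℝ)) := by
    have h1 : (χ : C(X, ℝ)) = (m + 2 : ℝ)⁻¹ • ∑ i, (Φ i : C(X, ℝ)) := by
      rw [hχ, average, Submodule.coe_smul, AddSubmonoidClass.coe_finsetSum]
    rw [h1]
    intro x
    have h2 : ∑ i, (Φ i : C(X, ℝ)) x ≤ (Φ 0 : C(X, ℝ)) x := by
      rw [← Finset.add_sum_erase _ _ (Finset.mem_univ 0)]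
      have : ∑ i ∈ Finset.univ.erase 0, (Φ i : C(X, ℝ)) x ≤ 0 :=
        Finset.sum_nonpos fun i _ => hΦn i x
      linarith
    change (m + 2 : ℝ)⁻¹ * (∑ i, (Φ i : C(X, ℝ))) x ≤ (m + 2 : ℝ)⁻¹ * (Φ 0 : C(X, ℝ)) x
    rw [ContinuousMap.sum_apply]
    exact mul_le_mul_of_nonneg_left h2 (by positivity)
  have hχn : (χ : C(X, ℝ)) ≤ 0 := hχle.trans fun x => by
    have := hΦn 0 x
    change (m + 2 : ℝ)⁻¹ * (Φ 0 : C(X, ℝ)) x ≤ 0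
    exact mul_nonpos_of_nonneg_of_nonpos (by positivity) this
  -- As χ ≤ 0, all terms of its energy are nonpositive, so the energy bound applies to the pure
  -- Monge-Ampère term alone.
  have h1 : S.integral (-(χ : C(X, ℝ))) (fun _ => ω + S.ddc χ) ≤ (m + 2) * (S.vol ω * K) := by
    have h2 : -((m + 2) * (S.vol ω * K)) ≤ S.pairing (fun _ => ω) (fun _ => χ) := by
      rw [energy, le_div_iff₀ (by positivity)] at hE
      push_cast at hE
      linarith
    rw [pairing_const, Finset.sum_range_succ'] at h2
    have h3 : ∑ k ∈ Finset.range (m + 1), S.integral χ (mixed (m + 1) ω (ω + S.ddc χ) (k + 1))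
        ≤ 0 := Finset.sum_nonpos fun k _ => by
      have := S.integral_nonneg (neg_nonneg.2 hχn) (mixed (m + 1) ω (ω + S.ddc χ) (k + 1))
        (fun j => by
          by_cases h : (j : ℕ) < k + 1
          · simpa [mixed, h] using hω
          · simpa [mixed, h] using hχp)
      rw [integral_neg] at this
      linarith
    have h4 : mixed (m + 1) ω (ω + S.ddc χ) 0 = fun _ => ω + S.ddc χ := by
      ext j; simp [mixed]
    rw [h4] at h2
    rw [integral_neg]
    linarith
  have h2 : S.integral (-(χ : C(X, ℝ))) (fun j => (m + 2 : ℝ)⁻¹ • (ω + S.ddc (ψ j))) ≤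
      S.integral (-(χ : C(X, ℝ))) (fun _ => ω + S.ddc χ) := by
    refine (S.integral _).le_of_le (fun ζ h => S.integral_nonneg (neg_nonneg.2 hχn) ζ h) _ _
      (fun j => smul_nonneg (by positivity) (hψ j).1) fun j => ?_
    have := S.smul_le_add_ddc_average hΦp j.succ
    simpa [hΦ, hΨ, ddc_normalized] using this
  rw [MultilinearMap.map_smul_univ] at h2
  simp only [Finset.prod_const, Finset.card_univ, Fintype.card_fin, smul_eq_mul] at h2
  have h3 : S.integral (-((m + 2 : ℝ)⁻¹ • (Φ 0 : C(X, ℝ)))) (fun j => ω + S.ddc (ψ j)) ≤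
      S.integral (-(χ : C(X, ℝ))) (fun j => ω + S.ddc (ψ j)) :=
    S.integral_mono (neg_le_neg hχle) _ fun j => (hψ j).1
  rw [← smul_neg, integral_smul] at h3
  have h4 : (m + 2 : ℝ)⁻¹ ^ (m + 1) * ((m + 2 : ℝ)⁻¹ *
      S.integral (-(Φ 0 : C(X, ℝ))) (fun j => ω + S.ddc (ψ j))) ≤ (m + 2) * (S.vol ω * K) :=
    (mul_le_mul_of_nonneg_left h3 (by positivity)).trans (h2.trans h1)
  have h5 := mul_le_mul_of_nonneg_left h4 (pow_pos hN (m + 2)).le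
  have e0 : Φ 0 = S.normalized ω T φ := by simp [hΦ, hΨ]
  rw [e0] at h5
  calc _ = _ := ?_
    _ ≤ _ := h5
    _ = _ := by ring
  have e1 : (m + 2 : ℝ) ^ (m + 2) * (m + 2 : ℝ)⁻¹ ^ (m + 2) = 1 := by
    rw [← mul_pow, mul_inv_cancel₀ hN.ne', one_pow]
  rw [← mul_assoc _ (m + 2 : ℝ)⁻¹, ← pow_succ, ← mul_assoc, e1, one_mul]

theorem dirForm_constD_left (c : ℝ) (v : S.D) (Γ : Fin m → Z) :
    S.dirForm (S.constD c) v Γ = 0 := by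
  rw [dirForm_symm, dirForm_apply, ddc_constD, neg_eq_zero]
  exact (S.integral v).map_coord_zero 0 (by simp)

/-- The Dirichlet form is bounded on functions of bounded energy. -/
theorem dirForm_self_le {ω : Z} (hω : 0 ≤ ω) (hV : 0 < S.vol ω) {T K : ℝ}
    (hT : S.SubmeanBound ω T) {φ : S.D} (hφ : S.EnergyBounded ω T K φ)
    {ψ : Fin m → S.D} (hψ : ∀ j, S.EnergyBounded ω T K (ψ j)) :
    S.dirForm φ φ (fun j => ω + S.ddc (ψ j)) ≤ (m + 2) ^ (m + 3) * (S.vol ω * K) := by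
  have e1 : S.dirForm φ φ (fun j => ω + S.ddc (ψ j)) =
      S.dirForm (S.normalized ω T φ) φ (fun j => ω + S.ddc (ψ j)) := by
    rw [normalized, dirForm_add_left, dirForm_constD_left, add_zero]
  have e2 : S.ddc φ = (ω + S.ddc φ) - ω := by abel
  have h1 := S.integral_neg_normalized_le hω hV hT hφ
    (ψ := Fin.cons φ ψ) (fun j => by
      refine Fin.cases ?_ (fun j => ?_) j
      · simpa using hφ
      · simpa using hψ j)
  have e3 : (fun j => ω + S.ddc ((Fin.cons φ ψ : Fin (m + 1) → S.D) j)) =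
      Fin.cons (ω + S.ddc φ) (fun j => ω + S.ddc (ψ j)) := by
    ext j
    refine Fin.cases ?_ (fun j => ?_) j <;> simp
  rw [e3] at h1
  -- With ddᶜφ = ω_φ - ω, the part containing ω has a favorable sign and is dropped.
  have h2 := S.integral_nonneg (neg_nonneg.2 (hT.normalized_nonpos hφ.1))
    (Fin.cons ω (fun j => ω + S.ddc (ψ j))) (fun j => by
      refine Fin.cases ?_ (fun j => ?_) j
      · simpa using hω
      · exact (hψ j).1)
  rw [e1, dirForm_apply, ← MultilinearMap.curryLeft_apply, e2, map_sub]
  rw [integral_neg] at h1 h2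
  simp only [_root_.sub_apply, MultilinearMap.curryLeft_apply]
  linarith

theorem dirForm_sub_self_le (u v : S.D) (Γ : Fin m → Z) (hΓ : ∀ j, 0 ≤ Γ j) :
    S.dirForm (u - v) (u - v) Γ ≤ 2 * S.dirForm u u Γ + 2 * S.dirForm v v Γ := by
  have h := S.dirForm_self_nonneg (u + v) Γ hΓ
  rw [sub_eq_add_neg]
  simp only [dirForm_add_left, dirForm_add_right, dirForm_neg_left, dirForm_neg_right] at h ⊢
  linarith

/-- J_ω(0, ·) = μ_ω - E is convex, because E is concave and μ_ω is linear. -/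
theorem EnergyBounded.midpoint {S : PluripotentialSetup X Z (m + 1)} {ω : Z} {T K : ℝ}
    (hV : 0 < S.vol ω) {φ ψ : S.D} (hφ : S.EnergyBounded ω T K φ)
    (hψ : S.EnergyBounded ω T K ψ) : S.EnergyBounded ω T K ((1 / 2 : ℝ) • (φ + ψ)) := by
  have hχ : (1 / 2 : ℝ) • (φ + ψ) ∈ S.psh ω := by
    have := S.psh_segment hφ.1 hψ.1 (t := 1 / 2) (by norm_num) (by norm_num)
    change 0 ≤ ω + S.ddc _
    convert this using 3
    module
  refine ⟨hχ, ?_⟩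
  have h1 := S.energy_le_add_MA hV hχ hφ.1
  have h2 := S.energy_le_add_MA hV hχ hψ.1
  have h3 := hφ.2
  have h4 := hψ.2
  set χ := (1 / 2 : ℝ) • (φ + ψ) with hχdef
  have h5 : S.MA ω χ ((φ - χ : S.D) : C(X, ℝ)) + S.MA ω χ ((ψ - χ : S.D) : C(X, ℝ)) = 0 := by
    rw [← map_add, ← Submodule.coe_add]
    have : (φ - χ) + (ψ - χ) = 0 := by rw [hχdef]; module
    rw [this]
    simp
  have h6 : S.mu ω χ = (1 / 2) * (S.mu ω φ + S.mu ω ψ) := by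
    rw [hχdef, Submodule.coe_smul, map_smul, Submodule.coe_add, map_add, smul_eq_mul]
  rw [dirichlet_zero_left] at h3 h4 ⊢
  linarith

theorem energyBounded_zero {ω : Z} (hω : 0 ≤ ω) {T K : ℝ} (hK : T ≤ K) :
    S.EnergyBounded ω T K 0 := by
  refine ⟨S.zero_mem_psh hω, ?_⟩
  rw [dirichlet_zero_left, energy_zero]
  simpa using hK

theorem EnergyBounded.le {S : PluripotentialSetup X Z (m + 1)} {ω : Z} (hω : 0 ≤ ω) {T K : ℝ}
    (hV : 0 < S.vol ω) {φ : S.D} (hφ : S.EnergyBounded ω T K φ) : T ≤ K := by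
  have := S.dirichlet_nonneg hV (S.zero_mem_psh hω) hφ.1
  linarith [hφ.2]

end PluripotentialSetup
end

/-! ### Hölder estimates for Dirichlet forms -/

noncomputable section

/-- Closes the bootstrap on energy bounds. With r the power of K / L, one has K ≤ L r, so 1 ≤ (4 +
c) r; raising to the power 2^k recovers K / L. -/
theorem le_of_le_add_mul_rpow {K L c : ℝ} (hK : 0 < K) (hKL : K ≤ L) (k : ℕ)
    (h : L ≤ 4 * K + c * (L * (K / L) ^ ((1 / 2 : ℝ) ^ k))) : L ≤ (4 + c) ^ (2 ^ k) * K := by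
  have hL : 0 < L := hK.trans_le hKL
  have hq : 0 < K / L := by positivity
  have hq1 : K / L ≤ 1 := (div_le_one hL).2 hKL
  set r := (K / L) ^ ((1 / 2 : ℝ) ^ k) with hr
  have hr0 : 0 < r := Real.rpow_pos_of_pos hq _
  have hr1 : r ≤ 1 := Real.rpow_le_one hq.le hq1 (by positivity)
  have hrk : r ^ (2 ^ k) = K / L := by
    rw [hr, ← Real.rpow_natCast, ← Real.rpow_mul hq.le]
    push_cast
    rw [← mul_pow]
    norm_num
  have h1 : K / L ≤ r := by
    rw [← hrk]
    exact pow_le_of_le_one hr0.le hr1 (by positivity)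
  have h2 : K ≤ L * r := by rwa [div_le_iff₀ hL, mul_comm] at h1
  have h3 : L * 1 ≤ L * ((4 + c) * r) := by linarith
  have h4 : 1 ≤ (4 + c) * r := le_of_mul_le_mul_left h3 hL
  have h5 : 1 ≤ ((4 + c) * r) ^ (2 ^ k) := one_le_pow₀ h4
  rw [mul_pow, hrk, ← mul_div_assoc, le_div_iff₀ hL] at h5
  linarith

namespace PluripotentialSetup

variable {X : Type*} [TopologicalSpace X] [CompactSpace X] [T2Space X]
  {Z : Type*} [AddCommGroup Z] [Module ℝ Z] [PartialOrder Z] [IsOrderedAddMonoid Z]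
  [IsOrderedModule ℝ Z] {m : ℕ} (S : PluripotentialSetup X Z (m + 1))

/-- A nonnegative form of positive volume with submean constant `T`. -/
structure Admissible (ω : Z) (T : ℝ) : Prop where
  nonneg : 0 ≤ ω
  vol_pos : 0 < S.vol ω
  submean : S.SubmeanBound ω T

/-- The a priori bound of Dirichlet forms of functions with energy at most `K`. -/
def aprioriBound (ω : Z) (K : ℝ) : ℝ := 36 * (m + 2) ^ (m + 3) * (S.vol ω * K)

/-- The Dirichlet form of `φ - φ'` at the midpoint. -/
def midForm (ω : Z) (φ φ' : S.D) : ℝ :=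
  S.dirForm (φ - φ') (φ - φ') (fun _ => ω + S.ddc ((1 / 2 : ℝ) • (φ + φ')))

/-- The modulus `B (Q / B) ^ α` with `α = 2⁻ⁿ`, where `B` is the a priori bound and `Q` is the
Dirichlet form of `φ - φ'` at the midpoint. -/
def modulus (ω : Z) (K : ℝ) (φ φ' : S.D) : ℝ :=
  S.aprioriBound ω K * (S.midForm ω φ φ' / S.aprioriBound ω K) ^ ((1 / 2 : ℝ) ^ (m + 1))

/-- Forms `ζ` with `± ζ ≤ b (ω + ddᶜψ)` for some `ψ` of energy at most `K`. -/
def Dominated (ω : Z) (T K b : ℝ) (ζ : Z) : Prop :=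
  ∃ ψ : S.D, S.EnergyBounded ω T K ψ ∧ ζ ≤ b • (ω + S.ddc ψ) ∧ -ζ ≤ b • (ω + S.ddc ψ)

variable {S} {ω : Z} {T K : ℝ}

theorem aprioriBound_pos (hA : S.Admissible ω T) (hK : 0 < K) : 0 < S.aprioriBound ω K := by
  have := hA.vol_pos
  unfold aprioriBound
  positivity

theorem midForm_symm (φ φ' : S.D) : S.midForm ω φ φ' = S.midForm ω φ' φ := by
  rw [midForm, midForm, ← neg_sub φ' φ, dirForm_neg_left, dirForm_neg_right, neg_neg, add_comm φ φ']

theorem midForm_nonneg (hA : S.Admissible ω T) {φ φ' : S.D}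
    (hφ : S.EnergyBounded ω T K φ) (hφ' : S.EnergyBounded ω T K φ') : 0 ≤ S.midForm ω φ φ' :=
  S.dirForm_self_nonneg _ _ fun _ => (hφ.midpoint hA.vol_pos hφ').1

/-- The difference costs a factor 4 over `dirForm_self_le`, and 36 = 4 · 9. The spare 9 becomes a
factor 3 under square roots, which absorbs the constants of the Hölder induction. -/
theorem dirForm_sub_self_le_aprioriBound (hA : S.Admissible ω T) {φ φ' : S.D}
    (hφ : S.EnergyBounded ω T K φ) (hφ' : S.EnergyBounded ω T K φ')
    {ψ : Fin m → S.D} (hψ : ∀ j, S.EnergyBounded ω T K (ψ j)) :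
    S.dirForm (φ - φ') (φ - φ') (fun j => ω + S.ddc (ψ j)) ≤ S.aprioriBound ω K / 9 := by
  have h1 := S.dirForm_self_le hA.nonneg hA.vol_pos hA.submean hφ hψ
  have h2 := S.dirForm_self_le hA.nonneg hA.vol_pos hA.submean hφ' hψ
  have h3 := S.dirForm_sub_self_le φ φ' (fun j => ω + S.ddc (ψ j)) fun j => (hψ j).1
  rw [aprioriBound]
  linarith

theorem midForm_le_aprioriBound (hA : S.Admissible ω T) (hK : 0 < K) {φ φ' : S.D}
    (hφ : S.EnergyBounded ω T K φ) (hφ' : S.EnergyBounded ω T K φ') :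
    S.midForm ω φ φ' ≤ S.aprioriBound ω K := by
  have h1 := dirForm_sub_self_le_aprioriBound hA hφ hφ'
    (ψ := fun _ => (1 / 2 : ℝ) • (φ + φ')) fun _ => hφ.midpoint hA.vol_pos hφ'
  have h2 := aprioriBound_pos hA hK
  rw [midForm]
  linarith

theorem modulus_nonneg (hA : S.Admissible ω T) (hK : 0 < K) {φ φ' : S.D}
    (hφ : S.EnergyBounded ω T K φ) (hφ' : S.EnergyBounded ω T K φ') :
    0 ≤ S.modulus ω K φ φ' := by
  have h1 := aprioriBound_pos hA hK
  have h2 := midForm_nonneg hA hφ hφ'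
  unfold modulus
  positivity

/-- Hölder estimate for the Dirichlet forms of a difference. -/
theorem dirForm_sub_self_piecewise_le (hA : S.Admissible ω T) (hK : 0 < K) {φ φ' : S.D}
    (hφ : S.EnergyBounded ω T K φ) (hφ' : S.EnergyBounded ω T K φ')
    {ψ : Fin m → S.D} (hψ : ∀ j, S.EnergyBounded ω T K (ψ j)) (s : Finset (Fin m)) :
    S.dirForm (φ - φ') (φ - φ') (s.piecewise (fun j => ω + S.ddc (ψ j))
        (fun _ => ω + S.ddc ((1 / 2 : ℝ) • (φ + φ')))) ≤
      S.aprioriBound ω K *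
        (S.midForm ω φ φ' / S.aprioriBound ω K) ^ ((1 / 2 : ℝ) ^ s.card) := by
  have hB := aprioriBound_pos hA hK
  have hQ := midForm_nonneg hA hφ hφ'
  have hχ := hφ.midpoint hA.vol_pos hφ'
  set B := S.aprioriBound ω K with hBdef
  set χ := (1 / 2 : ℝ) • (φ + φ') with hχdef
  set u := φ - φ' with hu
  have hx : 0 ≤ S.midForm ω φ φ' / B := by positivity
  induction s using Finset.induction_on with
  | empty =>
    simp only [Finset.piecewise_empty, Finset.card_empty, pow_zero, Real.rpow_one]
    rw [mul_div_cancel₀ _ hB.ne']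
    exact le_rfl
  | insert j s hj ih =>
    set Γ := s.piecewise (fun j => ω + S.ddc (ψ j)) (fun _ => ω + S.ddc χ) with hΓ
    have hΓe : Γ = fun i => ω + S.ddc (s.piecewise ψ (fun _ => χ) i) := by
      ext i
      by_cases hi : i ∈ s <;> simp [hΓ, hi]
    have hΓb : ∀ i, S.EnergyBounded ω T K (s.piecewise ψ (fun _ => χ) i) := by
      intro i
      by_cases hi : i ∈ s
      · simpa [hi] using hψ i
      · simpa [hi] using hχ
    have hΓ0 : ∀ i, 0 ≤ Γ i := fun i => by rw [hΓe]; exact (hΓb i).1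
    have hΓj : Γ j = ω + S.ddc χ := by simp [hΓ, hj]
    -- The new entry differs from ω_χ by ddᶜ(ψ j - χ), which is exchanged with ddᶜu: the error
    -- becomes a mixed form in u and ψ j - χ.
    have hsplit : S.dirForm u u ((insert j s).piecewise (fun j => ω + S.ddc (ψ j))
        (fun _ => ω + S.ddc χ)) =
        S.dirForm u u Γ + S.dirForm u (ψ j - χ) (Function.update Γ j (S.ddc u)) := by
      have e : ω + S.ddc (ψ j) = Γ j + S.ddc (ψ j - χ) := by
        rw [hΓj, map_sub]; abel
      rw [Finset.piecewise_insert, ← hΓ, e, MultilinearMap.map_update_add,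
        Function.update_eq_self, dirForm_update_ddc]
    have hCS := S.abs_dirForm_le u (ψ j - χ) (Function.update Γ j (S.ddc u))
      (Function.update Γ j ((2 : ℝ) • Γ j))
    have e2 : (2 : ℝ) • Γ j = (ω + S.ddc φ) + (ω + S.ddc φ') := by
      rw [hΓj, hχdef]
      simp only [map_smul, map_add]
      module
    have hself : ∀ i, -Γ i ≤ Γ i := fun i => (neg_nonpos.2 (hΓ0 i)).trans (hΓ0 i)
    replace hCS := hCS (by
      intro i
      by_cases hi : i = j
      · subst hi
        simp only [Function.update_self]
        rw [e2, ← sub_nonneg, hu, map_sub]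
        have : ω + S.ddc φ + (ω + S.ddc φ') - (S.ddc φ - S.ddc φ') =
          (2 : ℝ) • (ω + S.ddc φ') := by module
        rw [this]
        exact smul_nonneg (by norm_num) hφ'.1
      · simp [hi]) (by
      intro i
      by_cases hi : i = j
      · subst hi
        simp only [Function.update_self]
        rw [e2, ← sub_nonneg, hu, map_sub]
        have : ω + S.ddc φ + (ω + S.ddc φ') - -(S.ddc φ - S.ddc φ') =
          (2 : ℝ) • (ω + S.ddc φ) := by module
        rw [this]
        exact smul_nonneg (by norm_num) hφ.1
      · simpa [hi] using hself i)
    simp only [MultilinearMap.map_update_smul, Function.update_eq_self, smul_eq_mul] at hCS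
    have hq0 := S.dirForm_self_nonneg u Γ hΓ0
    have hq1 : S.dirForm u u Γ ≤ B / 9 := by
      rw [hΓe]; exact dirForm_sub_self_le_aprioriBound hA hφ hφ' hΓb
    have hv1 : S.dirForm (ψ j - χ) (ψ j - χ) Γ ≤ B / 9 := by
      rw [hΓe]; exact dirForm_sub_self_le_aprioriBound hA (hψ j) hχ hΓb
    set q := S.dirForm u u Γ
    rw [Real.sqrt_mul (by norm_num), Real.sqrt_mul (by norm_num)] at hCS
    have hs2 : √(2 : ℝ) * √2 = 2 := Real.mul_self_sqrt (by norm_num)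
    have hv2 := Real.sqrt_le_sqrt hv1
    have hq2 := Real.sqrt_le_sqrt hq1
    have hq3 : √q * √q = q := Real.mul_self_sqrt hq0
    have hB9 : √(B / 9) = √B / 3 := by
      rw [Real.sqrt_div hB.le]
      congr 1
      rw [show (9 : ℝ) = 3 ^ 2 by norm_num]
      exact Real.sqrt_sq (by norm_num)
    rw [hB9] at hv2 hq2
    -- The two terms are at most √q · √B / 3 and 2 √q · √B / 3, so no constant accumulates in the
    -- induction.
    have hmain : S.dirForm u u ((insert j s).piecewise (fun j => ω + S.ddc (ψ j))
        (fun _ => ω + S.ddc χ)) ≤ √B * √q := by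
      rw [hsplit]
      have h1 := (le_abs_self _).trans hCS
      have h2 := mul_le_mul_of_nonneg_left hv2 (Real.sqrt_nonneg q)
      have h3 := mul_le_mul_of_nonneg_left hq2 (Real.sqrt_nonneg q)
      have h4 : √2 * √q * (√2 * √(S.dirForm (ψ j - χ) (ψ j - χ) Γ)) =
          2 * (√q * √(S.dirForm (ψ j - χ) (ψ j - χ) Γ)) := by
        linear_combination (√q * √(S.dirForm (ψ j - χ) (ψ j - χ) Γ)) * hs2
      rw [h4] at h1
      linarith
    refine hmain.trans ?_
    have h5 := Real.sqrt_le_sqrt ih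
    rw [Real.sqrt_mul hB.le] at h5
    have h6 : √((S.midForm ω φ φ' / B) ^ ((1 / 2 : ℝ) ^ s.card)) =
        (S.midForm ω φ φ' / B) ^ ((1 / 2 : ℝ) ^ (insert j s).card) := by
      rw [Real.sqrt_eq_rpow, ← Real.rpow_mul hx, Finset.card_insert_of_notMem hj, pow_succ]
    rw [h6] at h5
    have h7 := mul_le_mul_of_nonneg_left h5 (Real.sqrt_nonneg B)
    rwa [← mul_assoc, Real.mul_self_sqrt hB.le] at h7

/-- Mixed Dirichlet forms are controlled by the modulus. -/
theorem abs_dirForm_sub_le (hA : S.Admissible ω T) (hK : 0 < K) {φ φ' v : S.D}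
    (hφ : S.EnergyBounded ω T K φ) (hφ' : S.EnergyBounded ω T K φ')
    (hv : S.EnergyBounded ω T K v) {ζ : Fin m → Z} {b : Fin m → ℝ} (hb : ∀ j, 0 ≤ b j)
    (hζ : ∀ j, S.Dominated ω T K (b j) (ζ j)) :
    |S.dirForm (φ - φ') v ζ| ≤ (∏ j, b j) * S.modulus ω K φ φ' := by
  choose ψ hψ h1 h2 using hζ
  have hCS := S.abs_dirForm_le (φ - φ') v ζ _ h1 h2
  have hB := aprioriBound_pos hA hK
  have hQ := midForm_nonneg hA hφ hφ'
  have hx : 0 ≤ S.midForm ω φ φ' / S.aprioriBound ω K := by positivity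
  have hP : 0 ≤ ∏ j, b j := Finset.prod_nonneg fun j _ => hb j
  rw [MultilinearMap.map_smul_univ, MultilinearMap.map_smul_univ, smul_eq_mul, smul_eq_mul,
    Real.sqrt_mul hP, Real.sqrt_mul hP] at hCS
  -- With all m entries replaced the exponent is 2⁻ᵐ; the square root from Cauchy-Schwarz turns it
  -- into 2^(-(m + 1)).
  have hu := dirForm_sub_self_piecewise_le hA hK hφ hφ' hψ Finset.univ
  rw [Finset.piecewise_univ, Finset.card_univ, Fintype.card_fin] at hu
  have hv' : S.dirForm v v (fun j => ω + S.ddc (ψ j)) ≤ S.aprioriBound ω K := by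
    have := S.dirForm_self_le hA.nonneg hA.vol_pos hA.submean hv hψ
    have h0 := mul_pos hA.vol_pos hK
    have h3 : (0 : ℝ) < (m + 2) ^ (m + 3) * (S.vol ω * K) := by positivity
    rw [aprioriBound]
    linarith
  have hu' := Real.sqrt_le_sqrt hu
  rw [Real.sqrt_mul hB.le, Real.sqrt_eq_rpow ((_ : ℝ) ^ (_ : ℝ)), ← Real.rpow_mul hx,
    ← pow_succ] at hu'
  have h3 := mul_le_mul hu' (Real.sqrt_le_sqrt hv') (Real.sqrt_nonneg _) (by positivity)
  have h4 := mul_le_mul_of_nonneg_left h3 hP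
  have h5 := Real.mul_self_sqrt hP
  have h6 := Real.mul_self_sqrt hB.le
  rw [mul_right_comm (√(S.aprioriBound ω K)), h6] at h4
  calc _ ≤ _ := hCS
    _ = (√(∏ j, b j) * √(∏ j, b j)) * (√(S.dirForm (φ - φ') (φ - φ') fun j => ω + S.ddc (ψ j)) *
        √(S.dirForm v v fun j => ω + S.ddc (ψ j))) := mul_mul_mul_comm _ _ _ _
    _ = (∏ j, b j) * (√(S.dirForm (φ - φ') (φ - φ') fun j => ω + S.ddc (ψ j)) *
        √(S.dirForm v v fun j => ω + S.ddc (ψ j))) := by rw [h5]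
    _ ≤ _ := h4

theorem EnergyBounded.dominated {ψ : S.D} (h : S.EnergyBounded ω T K ψ) :
    S.Dominated ω T K 1 (ω + S.ddc ψ) :=
  ⟨ψ, h, by rw [one_smul], by
    rw [one_smul]
    exact (neg_nonpos.2 h.1).trans h.1⟩

/-- Monge-Ampère integrals of a normalized difference are controlled by the modulus. -/
theorem abs_integral_sub_MA_le (hA : S.Admissible ω T) (hK : 0 < K) {φ φ' h : S.D}
    (hφ : S.EnergyBounded ω T K φ) (hφ' : S.EnergyBounded ω T K φ')
    (hh : S.EnergyBounded ω T K h) (hμ : S.mu ω φ = S.mu ω φ') :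
    |S.integral (φ - φ' : S.D) (fun _ => ω + S.ddc h)| ≤ (m + 1) * S.modulus ω K φ φ' := by
  have h0 : S.integral (φ - φ' : S.D) (fun _ => ω) = 0 := by
    rw [← S.vol_mul_mu hA.vol_pos, Submodule.coe_sub, map_sub, hμ, sub_self, mul_zero]
  -- The integral against ωⁿ is zero by normalization, so only the m + 1 exact replacements count.
  have h1 := (S.integral (φ - φ' : S.D)).abs_sub_le_of_update (fun _ => ω + S.ddc h) (fun _ => ω)
    (S.modulus ω K φ φ') (by
      intro s j hj
      rw [add_sub_cancel_left, integral_update_ddc, abs_neg]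
      have := abs_dirForm_sub_le hA hK hφ hφ' hh (b := fun _ => 1)
        (ζ := j.removeNth (s.piecewise (fun _ => ω + S.ddc h) (fun _ => ω)))
        (fun _ => zero_le_one) (fun i => by
          by_cases hi : j.succAbove i ∈ s
          · simpa [Fin.removeNth, hi] using hh.dominated
          · have hz := (S.energyBounded_zero hA.nonneg (hφ.le hA.nonneg hA.vol_pos)).dominated
            rw [map_zero, add_zero] at hz
            simpa [Fin.removeNth, hi] using hz)
      simpa using this)
  rw [h0, sub_zero] at h1
  exact_mod_cast h1

end PluripotentialSetup
end

/-! ### Measures bounded by ωⁿ: the variational argument -/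

noncomputable section
namespace PluripotentialSetup

variable {X : Type*} [TopologicalSpace X] [CompactSpace X] [T2Space X]
  {Z : Type*} [AddCommGroup Z] [Module ℝ Z] [PartialOrder Z] [IsOrderedAddMonoid Z]
  [IsOrderedModule ℝ Z] {m : ℕ} {S : PluripotentialSetup X Z (m + 1)} {ω : Z} {T K : ℝ}

/-- Enlarging the energy bound multiplies B by at most c and only decreases Q / B. -/
theorem modulus_le_mul (hA : S.Admissible ω T) (hK : 0 < K) {L c : ℝ} (hKL : K ≤ L)
    (hLc : L ≤ c * K) {φ φ' : S.D} (hφ : S.EnergyBounded ω T K φ)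
    (hφ' : S.EnergyBounded ω T K φ') : S.modulus ω L φ φ' ≤ c * S.modulus ω K φ φ' := by
  have hV := hA.vol_pos
  have hBK := aprioriBound_pos hA hK
  have hQ := midForm_nonneg hA hφ hφ'
  have h1 : S.aprioriBound ω K ≤ S.aprioriBound ω L := by
    unfold aprioriBound
    gcongr
  have h2 : S.aprioriBound ω L ≤ c * S.aprioriBound ω K := by
    have e : c * S.aprioriBound ω K = S.aprioriBound ω (c * K) := by unfold aprioriBound; ring
    rw [e]
    unfold aprioriBound
    gcongr
  have hBL := hBK.trans_le h1
  have hx : 0 ≤ S.midForm ω φ φ' / S.aprioriBound ω L := by positivity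
  have h3 : (S.midForm ω φ φ' / S.aprioriBound ω L) ^ ((1 / 2 : ℝ) ^ (m + 1)) ≤
      (S.midForm ω φ φ' / S.aprioriBound ω K) ^ ((1 / 2 : ℝ) ^ (m + 1)) := by
    gcongr
  unfold modulus
  rw [← mul_assoc]
  exact mul_le_mul h2 h3 (Real.rpow_nonneg hx _) (hBL.le.trans h2)

/-- Since Q is at most the a priori bound for K, the modulus grows sublinearly in L; this makes the
bootstrap possible. -/
theorem modulus_le_of_le (hA : S.Admissible ω T) (hK : 0 < K) {L : ℝ} (hKL : K ≤ L)
    {φ φ' : S.D} (hφ : S.EnergyBounded ω T K φ) (hφ' : S.EnergyBounded ω T K φ') :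
    S.modulus ω L φ φ' ≤
      36 * (m + 2) ^ (m + 3) * (S.vol ω * (L * (K / L) ^ ((1 / 2 : ℝ) ^ (m + 1)))) := by
  have hV := hA.vol_pos
  have hL := hK.trans_le hKL
  have hBL := aprioriBound_pos hA hL
  have hQ := midForm_nonneg hA hφ hφ'
  have h1 : S.midForm ω φ φ' / S.aprioriBound ω L ≤ K / L := by
    rw [div_le_div_iff₀ hBL hL]
    have := mul_le_mul_of_nonneg_right (midForm_le_aprioriBound hA hK hφ hφ') hL.le
    refine this.trans (le_of_eq ?_)
    unfold aprioriBound
    ring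
  calc S.modulus ω L φ φ' ≤
      S.aprioriBound ω L * (K / L) ^ ((1 / 2 : ℝ) ^ (m + 1)) := by
        unfold modulus
        gcongr
    _ = _ := by unfold aprioriBound; ring

/-- The factor by which the energy bound increases under projection to `ω`-psh functions. -/
def energyGain (m : ℕ) : ℝ := (4 + (m + 1) * (36 * (m + 2) ^ (m + 3))) ^ (2 ^ (m + 1))

theorem one_le_energyGain (m : ℕ) : 1 ≤ energyGain m := by
  refine one_le_pow₀ ?_
  have : (0 : ℝ) ≤ (m + 1) * (36 * (m + 2) ^ (m + 3)) := by positivity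
  linarith

/-- Lower bound of the integral of a normalized difference against a probability measure bounded
by `2 μ_ω`. -/
theorem neg_modulus_le_measure (hA : S.Admissible ω T) (hO : S.Orthogonality ω) (hK : 0 < K)
    {φ φ' : S.D} (hφ : S.EnergyBounded ω T K φ) (hφ' : S.EnergyBounded ω T K φ')
    (hμ : S.mu ω φ = S.mu ω φ') (ν : C(X, ℝ) →ₗ[ℝ] ℝ) (hν0 : ∀ f, 0 ≤ f → 0 ≤ ν f)
    (hν1 : ν 1 = 1) (hν2 : ∀ f, 0 ≤ f → ν f ≤ 2 * S.mu ω f) :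
    -((m + 1) * energyGain m * S.modulus ω K φ φ') ≤ S.vol ω * ν (φ - φ' : S.D) := by
  have hV := hA.vol_pos
  have hTK := hφ.le hA.nonneg hV
  set u := φ - φ' with hu
  have hmuu : S.mu ω u = 0 := by
    rw [hu, Submodule.coe_sub, map_sub, hμ, sub_self]
  -- Apply ν ≤ 2 μ_ω to the nonnegative function μ_ω(ψ) + T - ψ, whose μ_ω-integral is T.
  have hsub : ∀ ψ ∈ S.psh ω, S.mu ω ψ - ν ψ ≤ T := by
    intro ψ hψ
    have h0 := hA.submean.normalized_nonpos hψ
    have h1 := hν2 _ (neg_nonneg.2 h0)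
    have e : (S.normalized ω T ψ : C(X, ℝ)) =
        (ψ : C(X, ℝ)) + (-(S.mu ω ψ + T)) • (1 : C(X, ℝ)) := by
      rw [normalized, Submodule.coe_add, coe_constD]
    rw [e, map_neg, map_neg, map_add, map_add, map_smul, map_smul, hν1, S.mu_one hV] at h1
    simp only [smul_eq_mul] at h1
    linarith
  have hEμ : ∀ ψ ∈ S.psh ω, S.energy ω ψ ≤ S.mu ω ψ := by
    intro ψ hψ
    have := S.dirichlet_nonneg hV (S.zero_mem_psh hA.nonneg) hψ
    rw [dirichlet_zero_left] at this
    linarith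
  -- Formally a maximizer of E - ν solves MA = ν; near-maximizers suffice.
  set F : Set ℝ := {t | ∃ ψ ∈ S.psh ω, t = S.energy ω ψ - ν ψ} with hF
  have hFb : BddAbove F := by
    refine ⟨T, ?_⟩
    rintro _ ⟨ψ, hψ, rfl⟩
    linarith [hsub ψ hψ, hEμ ψ hψ]
  have hF0 : (0 : ℝ) ∈ F := ⟨0, S.zero_mem_psh hA.nonneg, by simp [energy_zero]⟩
  have hσ0 : 0 ≤ sSup F := le_csSup hFb hF0
  have key : ∀ e : ℝ, 0 < e → e ≤ K → -((m + 1) * energyGain m * S.modulus ω K φ φ') ≤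
      S.vol ω * ν u + 2 * S.vol ω * e := by
    intro e he heK
    obtain ⟨_, ⟨ψ, hψ, rfl⟩, hψσ⟩ := exists_lt_of_lt_csSup ⟨0, hF0⟩
      (sub_lt_self (sSup F) he)
    -- h approximates the ω-psh envelope of ψ + u; the threshold function of the orthogonality
    -- property itself is taken.
    obtain ⟨h, hh, hhlt, hhe⟩ := hO.2 (ψ + u) e he
    replace hhe := hhe h hh fun x => ⟨le_rfl, hhlt x⟩
    have hle : (h : C(X, ℝ)) ≤ (ψ : C(X, ℝ)) + (u : C(X, ℝ)) := fun x => (hhlt x).le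
    set z := S.MA ω h u with hz
    have hconc := S.energy_le_add_MA hV hh hψ
    have e1 : ((ψ - h : S.D) : C(X, ℝ)) = ((ψ + u - h : S.D) : C(X, ℝ)) - (u : C(X, ℝ)) := by
      simp only [Submodule.coe_sub, Submodule.coe_add]
      abel
    rw [e1, map_sub, ← hz] at hconc
    have hmuh : S.mu ω h ≤ S.mu ω ψ := by
      have := S.mu_mono hA.nonneg hV hle
      rw [map_add, hmuu, add_zero] at this
      exact this
    have hνh : ν h ≤ ν ψ + ν u := by
      have := hν0 _ (sub_nonneg.2 hle)
      rw [map_sub, map_add] at this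
      linarith
    -- Here μ_ω(h) ≤ μ_ω(ψ), as μ_ω(u) = 0, and E(h) ≥ E(ψ) - e + z ≥ ν(ψ) - 2e + z. The total is at
    -- most 2T + 2e + |z|, with T, e ≤ K.
    have hJh : S.dirichlet ω 0 h + T ≤ 4 * K + |z| := by
      rw [dirichlet_zero_left]
      have := hsub ψ hψ
      have := neg_abs_le z
      linarith
    set L := max K (S.dirichlet ω 0 h + T) with hL
    have hKL : K ≤ L := le_max_left _ _
    have hL0 := hK.trans_le hKL
    have hhL : S.EnergyBounded ω T L h := ⟨hh, le_max_right _ _⟩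
    have hzL := abs_integral_sub_MA_le hA hL0 (hφ.mono hKL) (hφ'.mono hKL) hhL hμ
    rw [← S.vol_mul_MA hV, abs_mul, abs_of_pos hV, ← hu, ← hz] at hzL
    -- Bootstrap: |z| is itself bounded by the modulus at level L, sublinear in L.
    have hLgain : L ≤ energyGain m * K := by
      rcases le_total (S.dirichlet ω 0 h + T) K with h1 | h1
      · rw [hL, max_eq_left h1]
        exact le_mul_of_one_le_left hK.le (one_le_energyGain m)
      · refine le_of_le_add_mul_rpow hK hKL _ ?_
        have h2 : L = S.dirichlet ω 0 h + T := max_eq_right h1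
        have h3 := modulus_le_of_le hA hK hKL hφ hφ'
        have h4 : S.vol ω * |z| ≤ S.vol ω * ((m + 1) * (36 * (m + 2) ^ (m + 3)) *
            (L * (K / L) ^ ((1 / 2 : ℝ) ^ (m + 1)))) := by
          refine hzL.trans ((mul_le_mul_of_nonneg_left h3 (by positivity)).trans (le_of_eq ?_))
          ring
        have h5 := le_of_mul_le_mul_left h4 hV
        linarith
    have hmod := modulus_le_mul hA hK hKL hLgain hφ hφ'
    have h6 : S.vol ω * |z| ≤ (m + 1) * energyGain m * S.modulus ω K φ φ' := by
      refine hzL.trans ((mul_le_mul_of_nonneg_left hmod (by positivity)).trans (le_of_eq ?_))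
      ring
    have h7 : S.energy ω h - ν h ≤ sSup F := le_csSup hFb ⟨h, hh, rfl⟩
    -- Concavity gives z ≤ E(h) - E(ψ) + e, near-maximality gives E(h) - E(ψ) ≤ ν(h) - ν(ψ) + e, and
    -- h ≤ ψ + u gives ν(h) - ν(ψ) ≤ ν(u).
    have h8 : z ≤ ν u + 2 * e := by linarith
    have h9 : -|z| ≤ ν u + 2 * e := (neg_abs_le z).trans h8
    have h10 := mul_le_mul_of_nonneg_left h9 hV.le
    linarith
  refine le_of_forall_pos_le_add fun ε hε => ?_
  have he : 0 < min K (ε / (2 * S.vol ω)) := lt_min hK (by positivity)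
  refine (key _ he (min_le_left _ _)).trans ?_
  have h1 : min K (ε / (2 * S.vol ω)) ≤ ε / (2 * S.vol ω) := min_le_right _ _
  rw [le_div_iff₀ (by positivity)] at h1
  linarith

theorem modulus_symm (φ φ' : S.D) : S.modulus ω K φ φ' = S.modulus ω K φ' φ := by
  rw [modulus, modulus, midForm_symm]

theorem abs_measure_sub_le (hA : S.Admissible ω T) (hO : S.Orthogonality ω) (hK : 0 < K)
    {φ φ' : S.D} (hφ : S.EnergyBounded ω T K φ) (hφ' : S.EnergyBounded ω T K φ')
    (hμ : S.mu ω φ = S.mu ω φ') (ν : C(X, ℝ) →ₗ[ℝ] ℝ) (hν0 : ∀ f, 0 ≤ f → 0 ≤ ν f)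
    (hν1 : ν 1 = 1) (hν2 : ∀ f, 0 ≤ f → ν f ≤ 2 * S.mu ω f) :
    S.vol ω * |ν (φ - φ' : S.D)| ≤ (m + 1) * energyGain m * S.modulus ω K φ φ' := by
  have h1 := neg_modulus_le_measure hA hO hK hφ hφ' hμ ν hν0 hν1 hν2
  have h2 := neg_modulus_le_measure hA hO hK hφ' hφ hμ.symm ν hν0 hν1 hν2
  have e : ((φ' - φ : S.D) : C(X, ℝ)) = -((φ - φ' : S.D) : C(X, ℝ)) := by simp
  rw [modulus_symm, e, map_neg] at h2
  have e2 : S.vol ω * |ν (φ - φ' : S.D)| = |S.vol ω * ν (φ - φ' : S.D)| := by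
    rw [abs_mul, abs_of_pos hA.vol_pos]
  rw [e2]
  exact abs_le.2 ⟨h1, by linarith⟩

/-- Forms `θ + ddᶜφ` with `± θ ≤ b ω` and `φ` of energy at most `K`. -/
def Twisted (S : PluripotentialSetup X Z (m + 1)) (ω : Z) (T K b : ℝ) (ζ : Z) : Prop :=
  ∃ (θ : Z) (φ : S.D), θ ≤ b • ω ∧ -θ ≤ b • ω ∧ S.EnergyBounded ω T K φ ∧ ζ = θ + S.ddc φ

theorem dominated_of_le (hA : S.Admissible ω T) (hTK : T ≤ K) {b : ℝ} {θ : Z} (h1 : θ ≤ b • ω)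
    (h2 : -θ ≤ b • ω) : S.Dominated ω T K b θ :=
  ⟨0, S.energyBounded_zero hA.nonneg hTK, by simpa using h1, by simpa using h2⟩

theorem Dominated.mono {b b' : ℝ} {ζ : Z} (h : S.Dominated ω T K b ζ) (hb : b ≤ b') :
    S.Dominated ω T K b' ζ := by
  obtain ⟨ψ, hψ, h1, h2⟩ := h
  have h3 : b • (ω + S.ddc ψ) ≤ b' • (ω + S.ddc ψ) := smul_le_smul_of_nonneg_right hb hψ.1
  exact ⟨ψ, hψ, h1.trans h3, h2.trans h3⟩

/-- The witness is φ / 2, because 2 (ω + ddᶜ(φ / 2)) = ω + ω_φ dominates both ω and ω_φ. -/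
theorem Twisted.dominated (hA : S.Admissible ω T) {b : ℝ} (hb : 0 ≤ b) {ζ : Z}
    (h : S.Twisted ω T K b ζ) : S.Dominated ω T K (2 * (1 + b)) ζ := by
  obtain ⟨θ, φ, h1, h2, hφ, rfl⟩ := h
  have h0 := S.energyBounded_zero hA.nonneg (hφ.le hA.nonneg hA.vol_pos)
  refine ⟨(1 / 2 : ℝ) • (φ + 0), hφ.midpoint hA.vol_pos h0, ?_, ?_⟩
  · rw [← sub_nonneg]
    have e : (2 * (1 + b)) • (ω + S.ddc ((1 / 2 : ℝ) • (φ + 0))) - (θ + S.ddc φ) =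
        (b • ω - θ) + b • (ω + S.ddc φ) + (2 : ℝ) • ω := by
      simp only [map_smul, add_zero]
      module
    rw [e]
    exact add_nonneg (add_nonneg (sub_nonneg.2 h1) (smul_nonneg hb hφ.1))
      (smul_nonneg (by norm_num) hA.nonneg)
  · rw [← sub_nonneg]
    have e : (2 * (1 + b)) • (ω + S.ddc ((1 / 2 : ℝ) • (φ + 0))) - -(θ + S.ddc φ) =
        (b • ω - -θ) + (2 + b) • (ω + S.ddc φ) := by
      simp only [map_smul, add_zero]
      module
    rw [e]
    exact add_nonneg (sub_nonneg.2 h2) (smul_nonneg (by linarith) hφ.1)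

theorem abs_integral_le_of_dominated {b : Fin (m + 1) → ℝ}
    {ζ γ : Fin (m + 1) → Z} (h1 : ∀ j, ζ j ≤ b j • γ j) (h2 : ∀ j, -ζ j ≤ b j • γ j)
    {f : C(X, ℝ)} (hf : 0 ≤ f) : |S.integral f ζ| ≤ (∏ j, b j) * S.integral f γ := by
  have := (S.integral f).abs_le_of_abs_le (fun ζ h => S.integral_nonneg hf ζ h) ζ _ h1 h2
  rwa [MultilinearMap.map_smul_univ, smul_eq_mul] at this

/-- Integrals of a normalized difference against products of bounded forms. -/
theorem abs_integral_sub_le_of_bounded (hA : S.Admissible ω T) (hO : S.Orthogonality ω)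
    (hK : 0 < K) {φ φ' : S.D} (hφ : S.EnergyBounded ω T K φ) (hφ' : S.EnergyBounded ω T K φ')
    (hμ : S.mu ω φ = S.mu ω φ') {θ : Fin (m + 1) → Z} {b : Fin (m + 1) → ℝ}
    (hb : ∀ j, 0 < b j) (h1 : ∀ j, θ j ≤ b j • ω) (h2 : ∀ j, -θ j ≤ b j • ω) :
    |S.integral (φ - φ' : S.D) θ| ≤
      (∏ j, b j) * (2 * ((m + 1) * energyGain m * S.modulus ω K φ φ')) := by
  have hV := hA.vol_pos
  have hP : 0 < ∏ j, b j := Finset.prod_pos fun j _ => hb j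
  set P := ∏ j, b j with hPdef
  have hL : ∀ f : C(X, ℝ), 0 ≤ f → |S.integral f θ| ≤ P * (S.vol ω * S.mu ω f) := by
    intro f hf
    rw [S.vol_mul_mu hV]
    exact abs_integral_le_of_dominated h1 h2 hf
  have hL1 := hL 1 (by intro x; simp)
  rw [S.mu_one hV, mul_one] at hL1
  -- Subtracting its mass times μ_ω makes the signed measure of θ have mass 0, and the scaling
  -- bounds it by μ_ω. Hence ν is a probability between 0 and 2 μ_ω, and μ_ω(φ - φ') = 0 lets ν
  -- recover the integral.
  let ν : C(X, ℝ) →ₗ[ℝ] ℝ := (S.mu ω : C(X, ℝ) →ₗ[ℝ] ℝ) + (2 * P * S.vol ω)⁻¹ •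
    ((S.wedge θ : C(X, ℝ) →ₗ[ℝ] ℝ) - (S.integral 1 θ) • (S.mu ω : C(X, ℝ) →ₗ[ℝ] ℝ))
  have hν : ∀ f, ν f = S.mu ω f +
      (2 * P * S.vol ω)⁻¹ * (S.integral f θ - S.integral 1 θ * S.mu ω f) := fun f => rfl
  have hc : 0 < 2 * P * S.vol ω := by positivity
  have habs : ∀ f : C(X, ℝ), 0 ≤ f →
      |S.integral f θ - S.integral 1 θ * S.mu ω f| ≤ 2 * P * S.vol ω * S.mu ω f := by
    intro f hf
    have hm := S.mu_nonneg hA.nonneg hV hf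
    have h3 := mul_le_mul_of_nonneg_right hL1 hm
    refine (abs_sub _ _).trans ?_
    rw [abs_mul, abs_of_nonneg hm]
    linarith [hL f hf]
  have hbd : ∀ f : C(X, ℝ), 0 ≤ f → |(2 * P * S.vol ω)⁻¹ *
      (S.integral f θ - S.integral 1 θ * S.mu ω f)| ≤ S.mu ω f := by
    intro f hf
    rw [abs_mul, abs_of_pos (inv_pos.2 hc), inv_mul_le_iff₀ hc]
    exact habs f hf
  have h3 := abs_measure_sub_le hA hO hK hφ hφ' hμ ν
    (fun f hf => by rw [hν]; linarith [(abs_le.1 (hbd f hf)).1])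
    (by rw [hν, S.mu_one hV]; ring)
    (fun f hf => by rw [hν]; linarith [(abs_le.1 (hbd f hf)).2])
  have hmuu : S.mu ω (φ - φ' : S.D) = 0 := by
    rw [Submodule.coe_sub, map_sub, hμ, sub_self]
  rw [hν, hmuu, mul_zero, sub_zero, zero_add, abs_mul, abs_of_pos (inv_pos.2 hc)] at h3
  have h4 := mul_le_mul_of_nonneg_left h3 (by positivity : 0 ≤ 2 * P)
  calc _ = 2 * P * (S.vol ω * ((2 * P * S.vol ω)⁻¹ * |S.integral (φ - φ' : S.D) θ|)) := by
        field_simp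
    _ ≤ _ := h4
    _ = _ := by ring

/-- The constant of the Hölder estimate for integrals of normalized differences. -/
def holderConst (m : ℕ) : ℝ := (m + 1) * 2 ^ (m + 1) + 2 * ((m + 1) * energyGain m)

/-- Integrals of a normalized difference against products of twisted forms. -/
theorem abs_integral_sub_le_of_twisted (hA : S.Admissible ω T) (hO : S.Orthogonality ω)
    (hK : 0 < K) {φ φ' : S.D} (hφ : S.EnergyBounded ω T K φ) (hφ' : S.EnergyBounded ω T K φ')
    (hμ : S.mu ω φ = S.mu ω φ') {ζ : Fin (m + 1) → Z} {b : Fin (m + 1) → ℝ}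
    (hb : ∀ j, 0 ≤ b j) (hζ : ∀ j, S.Twisted ω T K (b j) (ζ j)) :
    |S.integral (φ - φ' : S.D) ζ| ≤
      holderConst m * (∏ j, (1 + b j)) * S.modulus ω K φ φ' := by
  choose θ ψ h1 h2 hψ hζ' using hζ
  have hTK := hφ.le hA.nonneg hA.vol_pos
  have hmod := modulus_nonneg hA hK hφ hφ'
  have hle : ∀ j, b j • ω ≤ (1 + b j) • ω := fun j =>
    smul_le_smul_of_nonneg_right (by linarith) hA.nonneg
  have h3 := abs_integral_sub_le_of_bounded hA hO hK hφ hφ' hμ (b := fun j => 1 + b j)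
    (fun j => by linarith [hb j]) (fun j => (h1 j).trans (hle j)) (fun j => (h2 j).trans (hle j))
  have hP : 0 ≤ ∏ j, (1 + b j) := Finset.prod_nonneg fun j _ => by linarith [hb j]
  -- Removing the exact parts one slot at a time leaves mixed Dirichlet forms of φ - φ' and ψ j.
  have h4 := (S.integral (φ - φ' : S.D)).abs_sub_le_of_update ζ θ
    (2 ^ (m + 1) * (∏ j, (1 + b j)) * S.modulus ω K φ φ') (by
      intro s j hj
      rw [hζ', add_sub_cancel_left, integral_update_ddc, abs_neg]
      have h5 := abs_dirForm_sub_le hA hK hφ hφ' (hψ j)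
        (b := fun i => 2 * (1 + b (j.succAbove i)))
        (ζ := j.removeNth (s.piecewise ζ θ))
        (fun i => by linarith [hb (j.succAbove i)]) (fun i => by
          refine Twisted.dominated hA (hb _) ?_
          by_cases hi : j.succAbove i ∈ s
          · exact ⟨θ (j.succAbove i), ψ (j.succAbove i), h1 _, h2 _, hψ _, by simp [Fin.removeNth, hi, hζ']⟩
          · exact ⟨θ _, 0, h1 _, h2 _, S.energyBounded_zero hA.nonneg hTK, by
              simp [Fin.removeNth, hi]⟩)
      refine h5.trans (mul_le_mul_of_nonneg_right ?_ hmod)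
      rw [Fin.prod_univ_succAbove (fun j => 1 + b j) j, Finset.prod_mul_distrib]
      simp only [Finset.prod_const, Finset.card_univ, Fintype.card_fin]
      have h6 : 0 ≤ ∏ i, (1 + b (j.succAbove i)) :=
        Finset.prod_nonneg fun i _ => by linarith [hb (j.succAbove i)]
      have h7 : (1 : ℝ) ≤ 2 * (1 + b j) := by linarith [hb j]
      calc (2 : ℝ) ^ m * ∏ i, (1 + b (j.succAbove i)) ≤
          (2 * (1 + b j)) * (2 ^ m * ∏ i, (1 + b (j.succAbove i))) :=
            le_mul_of_one_le_left (by positivity) h7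
        _ = _ := by ring)
  have h8 := abs_sub_abs_le_abs_sub (S.integral (φ - φ' : S.D) ζ) (S.integral (φ - φ' : S.D) θ)
  rw [Nat.cast_add, Nat.cast_one] at h4
  calc _ ≤ (m + 1) * (2 ^ (m + 1) * (∏ j, (1 + b j)) * S.modulus ω K φ φ') +
        (∏ j, (1 + b j)) * (2 * ((m + 1) * energyGain m * S.modulus ω K φ φ')) := by linarith
    _ = _ := by rw [holderConst]; ring

/-- Integrals of a normalized function against products of dominated forms. -/
theorem abs_integral_le_of_normalized (hA : S.Admissible ω T) {φ : S.D}
    (hφ : S.EnergyBounded ω T K φ) (hμ : S.mu ω φ = 0)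
    {ζ : Fin (m + 1) → Z} {b : Fin (m + 1) → ℝ} (hb : ∀ j, 0 ≤ b j)
    (hζ : ∀ j, S.Dominated ω T K (b j) (ζ j)) :
    |S.integral φ ζ| ≤ (∏ j, b j) * (((m + 2) ^ (m + 3) + 1) * (S.vol ω * K)) := by
  choose ψ hψ h1 h2 using hζ
  have hV := hA.vol_pos
  have : Nonempty X := S.nonempty_of_vol_pos hV
  have hT0 := S.submeanBound_nonneg hA.nonneg hA.submean
  have hTK := hφ.le hA.nonneg hV
  have hP : 0 ≤ ∏ j, b j := Finset.prod_nonneg fun j _ => hb j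
  have h3 := abs_integral_le_of_dominated (S := S) h1 h2
    (neg_nonneg.2 (hA.submean.normalized_nonpos hφ.1))
  have h4 := mul_le_mul_of_nonneg_left
    (S.integral_neg_normalized_le hA.nonneg hV hA.submean hφ hψ) hP
  have h5 := abs_integral_le_of_dominated (S := S) h1 h2 (f := 1) (by intro x; simp)
  rw [S.integral_one_add_ddc (fun _ => ω) ψ, ← vol_eq] at h5
  -- A constant minus a nonnegative function: the constant sees only masses, the other part is
  -- bounded by the energy.
  have e : (φ : C(X, ℝ)) = T • (1 : C(X, ℝ)) - -(S.normalized ω T φ : C(X, ℝ)) := by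
    rw [normalized, Submodule.coe_add, coe_constD, hμ, zero_add, neg_smul]
    abel
  rw [e, integral_sub, integral_smul]
  refine (abs_sub _ _).trans ?_
  rw [abs_mul, abs_of_nonneg hT0]
  have h6 : T * |S.integral 1 ζ| ≤ K * ((∏ j, b j) * S.vol ω) :=
    mul_le_mul hTK h5 (abs_nonneg _) (hT0.trans hTK)
  linarith

end PluripotentialSetup
end

/-! ### Continuity of the energy pairing -/

noncomputable section
namespace PluripotentialSetup

variable {X : Type*} [TopologicalSpace X] [CompactSpace X] [T2Space X]
  {Z : Type*} [AddCommGroup Z] [Module ℝ Z] [PartialOrder Z] [IsOrderedAddMonoid Z]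
  [IsOrderedModule ℝ Z]

section

variable {n : ℕ}

theorem isClosed_setOf_le_smul (S : PluripotentialSetup X Z n) (ω θ : Z) : IsClosed {C : ℝ | θ ≤ C • ω} := by
  have h1 : IsClosed (planeMap ω θ ⁻¹' {θ : Z | 0 ≤ θ}) := by
    let := finestTopology Z
    exact S.isClosed_nonneg.preimage (continuous_finestTopology 2 _)
  have hc : Continuous fun s : ℝ => (![s, -1] : Fin 2 → ℝ) := by
    refine continuous_pi fun i => ?_
    fin_cases i
    · exact continuous_id
    · exact continuous_const
  have h2 := h1.preimage hc
  convert h2 using 1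
  ext C
  simp [planeMap_apply, ← sub_eq_add_neg]

/-- The infimum is attained because the positive cone is closed on planes, so the norm itself can
serve as a bound. -/
theorem formNorm_mem (S : PluripotentialSetup X Z n) {ω θ : Z} (h : FormBounded ω θ) : formNorm ω θ ∈ formBounds ω θ := by
  refine IsClosed.csInf_mem ?_ h ⟨0, fun C hC => hC.1⟩
  have h3 := (S.isClosed_setOf_le_smul ω θ).inter (S.isClosed_setOf_le_smul ω (-θ))
  exact isClosed_Ici.inter h3

end

omit [IsOrderedModule ℝ Z] in
theorem formBounded_sub {ω θ θ' : Z} (h : FormBounded ω θ) (h' : FormBounded ω θ') :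
    FormBounded ω (θ - θ') := by
  obtain ⟨C, h0, h1, h2⟩ := h
  obtain ⟨C', h0', h1', h2'⟩ := h'
  refine ⟨C + C', add_nonneg h0 h0', ?_, ?_⟩
  · rw [add_smul, sub_eq_add_neg]
    exact add_le_add h1 h2'
  · rw [add_smul, neg_sub, sub_eq_add_neg, add_comm]
    exact add_le_add h2 h1'

variable {m : ℕ} {S : PluripotentialSetup X Z (m + 1)} {ω : Z} {T K : ℝ}

/-- The function twisting the `j`-th form in the `i`-th term of the energy pairing. -/
def twist (φ : Fin (m + 2) → S.D) (i : Fin (m + 2)) (j : Fin (m + 1)) : S.D :=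
  if i.succAbove j < i then 0 else φ (i.succAbove j)

theorem pairing_eq_sum (θ : Fin (m + 2) → Z) (φ : Fin (m + 2) → S.D) :
    S.pairing θ φ =
      ∑ i, S.integral (φ i) (fun j => θ (i.succAbove j) + S.ddc (twist φ i j)) := by
  rw [pairing]
  refine Finset.sum_congr rfl fun i _ => ?_
  rw [integral_apply]
  congr 2
  ext j
  by_cases h : i.succAbove j < i <;> simp [twist, h]

theorem energyBounded_twist (hA : S.Admissible ω T) {φ : Fin (m + 2) → S.D}
    (hφ : ∀ i, S.EnergyBounded ω T K (φ i)) (i : Fin (m + 2)) (j : Fin (m + 1)) :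
    S.EnergyBounded ω T K (twist φ i j) := by
  unfold twist
  split
  · exact S.energyBounded_zero hA.nonneg ((hφ 0).le hA.nonneg hA.vol_pos)
  · exact hφ _

theorem mu_twist {φ : Fin (m + 2) → S.D} (hφ : ∀ i, S.mu ω (φ i) = 0) (i : Fin (m + 2))
    (j : Fin (m + 1)) : S.mu ω (twist φ i j) = 0 := by
  unfold twist
  split
  · simp
  · exact hφ _

theorem modulus_twist_le {φ φ' : Fin (m + 2) → S.D} {M : ℝ} (hM0 : 0 ≤ M)
    (hM : ∀ i, S.modulus ω K (φ i) (φ' i) ≤ M) (i : Fin (m + 2)) (j : Fin (m + 1)) :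
    S.modulus ω K (twist φ i j) (twist φ' i j) ≤ M := by
  unfold twist
  split
  · have h : S.midForm ω (0 : S.D) 0 = 0 := by
      rw [midForm, sub_self, ← zero_smul ℝ (0 : S.D), dirForm_smul_left, zero_mul]
    rw [modulus, h, zero_div, Real.zero_rpow (by positivity), mul_zero]
    exact hM0
  · exact hM _

theorem prod_succAbove_le {β : Fin (m + 2) → ℝ} (hβ : ∀ i, 0 ≤ β i) (i : Fin (m + 2)) :
    ∏ j, (1 + β (i.succAbove j)) ≤ ∏ i, (1 + β i) := by
  rw [Fin.prod_univ_succAbove (fun i => 1 + β i) i]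
  exact le_mul_of_one_le_left (Finset.prod_nonneg fun j _ => by linarith [hβ (i.succAbove j)])
    (by linarith [hβ i])

/-- The constant of the bound of the energy pairing. -/
def boundConst (m : ℕ) : ℝ := 2 ^ (m + 1) * ((m + 2) ^ (m + 3) + 1)

theorem boundConst_pos (m : ℕ) : 0 < boundConst m := by unfold boundConst; positivity

theorem holderConst_pos (m : ℕ) : 0 < holderConst m := by
  have := one_le_energyGain m
  have : 0 < energyGain m := by linarith
  unfold holderConst
  positivity

/-- The energy pairing is bounded on forms and functions of bounded size. -/
theorem abs_pairing_le (hA : S.Admissible ω T) (hK : 0 ≤ K) {θ : Fin (m + 2) → Z}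
    {φ : Fin (m + 2) → S.D} {b : Fin (m + 2) → ℝ} (hb : ∀ i, 0 ≤ b i)
    (h1 : ∀ i, θ i ≤ b i • ω) (h2 : ∀ i, -θ i ≤ b i • ω)
    (hφ : ∀ i, S.EnergyBounded ω T K (φ i)) (hμ : ∀ i, S.mu ω (φ i) = 0) :
    |S.pairing θ φ| ≤ (m + 2) * boundConst m * (S.vol ω * (∏ i, (1 + b i)) * K) := by
  have hV := hA.vol_pos
  rw [pairing_eq_sum]
  have hterm : ∀ i ∈ (Finset.univ : Finset (Fin (m + 2))),
      |S.integral (φ i) (fun j => θ (i.succAbove j) + S.ddc (twist φ i j))| ≤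
        boundConst m * (S.vol ω * (∏ i, (1 + b i)) * K) := by
    intro i _
    have h3 := abs_integral_le_of_normalized hA (hφ i) (hμ i)
      (ζ := fun j => θ (i.succAbove j) + S.ddc (twist φ i j))
      (b := fun j => 2 * (1 + b (i.succAbove j)))
      (fun j => by linarith [hb (i.succAbove j)])
      (fun j => Twisted.dominated hA (hb _)
        ⟨θ (i.succAbove j), twist φ i j, h1 _, h2 _, energyBounded_twist hA hφ i j, rfl⟩)
    rw [Finset.prod_mul_distrib] at h3
    simp only [Finset.prod_const, Finset.card_univ, Fintype.card_fin] at h3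
    have h4 : 0 ≤ boundConst m * (S.vol ω * K) :=
      mul_nonneg (boundConst_pos m).le (by positivity)
    have h5 := mul_le_mul_of_nonneg_right (prod_succAbove_le hb i) h4
    refine h3.trans (le_trans (le_of_eq ?_) (h5.trans (le_of_eq ?_)))
    · unfold boundConst; ring
    · ring
  refine (Finset.abs_sum_le_sum_abs _ _).trans ((Finset.sum_le_sum hterm).trans (le_of_eq ?_))
  simp only [Finset.sum_const, Finset.card_univ, Fintype.card_fin, nsmul_eq_mul]
  push_cast
  ring

/-- The energy pairing is Hölder continuous. -/
theorem abs_pairing_sub_le (hA : S.Admissible ω T) (hO : S.Orthogonality ω) (hK : 0 < K)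
    {θ θ' : Fin (m + 2) → Z} {φ φ' : Fin (m + 2) → S.D} {β : Fin (m + 2) → ℝ} {d M : ℝ}
    (hβ : ∀ i, 0 ≤ β i)
    (h1 : ∀ i, θ i ≤ β i • ω) (h2 : ∀ i, -θ i ≤ β i • ω)
    (h1' : ∀ i, θ' i ≤ β i • ω) (h2' : ∀ i, -θ' i ≤ β i • ω)
    (hd : 0 ≤ d) (hd1 : ∀ i, θ i - θ' i ≤ d • ω) (hd2 : ∀ i, -(θ i - θ' i) ≤ d • ω)
    (hφ : ∀ i, S.EnergyBounded ω T K (φ i)) (hφ' : ∀ i, S.EnergyBounded ω T K (φ' i))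
    (hμ : ∀ i, S.mu ω (φ i) = 0) (hμ' : ∀ i, S.mu ω (φ' i) = 0)
    (hM : ∀ i, S.modulus ω K (φ i) (φ' i) ≤ M) :
    |S.pairing θ φ - S.pairing θ' φ'| ≤ (m + 2) ^ 2 * (boundConst m + holderConst m) *
      ((∏ i, (1 + β i)) * (d * (S.vol ω * K) + M)) := by
  have hV := hA.vol_pos
  have hTK := (hφ 0).le hA.nonneg hV
  have hM0 : 0 ≤ M := (modulus_nonneg hA hK (hφ 0) (hφ' 0)).trans (hM 0)
  have hB := boundConst_pos m
  have hH := holderConst_pos m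
  set P := ∏ i, (1 + β i) with hP
  have hP0 : 0 < P := Finset.prod_pos fun i _ => by linarith [hβ i]
  have hVK : 0 < S.vol ω * K := mul_pos hV hK
  set R := P * (d * (S.vol ω * K) + M) with hR
  have hR0 : 0 ≤ R := by positivity
  rw [pairing_eq_sum, pairing_eq_sum, ← Finset.sum_sub_distrib]
  have hterm : ∀ i ∈ (Finset.univ : Finset (Fin (m + 2))),
      |S.integral (φ i) (fun j => θ (i.succAbove j) + S.ddc (twist φ i j)) -
        S.integral (φ' i) (fun j => θ' (i.succAbove j) + S.ddc (twist φ' i j))| ≤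
        (m + 2) * (boundConst m + holderConst m) * R := by
    intro i _
    set Γ : Fin (m + 1) → Z := fun j => θ (i.succAbove j) + S.ddc (twist φ i j) with hΓ
    set Γ' : Fin (m + 1) → Z := fun j => θ' (i.succAbove j) + S.ddc (twist φ' i j) with hΓ'
    have hPi := prod_succAbove_le hβ i
    set p : Fin (m + 1) → ℝ := fun j => β (i.succAbove j) with hp
    have hp0 : ∀ j, 0 ≤ p j := fun j => hβ _
    have hΓt : ∀ j, S.Twisted ω T K (p j) (Γ j) := fun j =>
      ⟨_, _, h1 _, h2 _, energyBounded_twist hA hφ i j, rfl⟩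
    have hΓt' : ∀ j, S.Twisted ω T K (p j) (Γ' j) := fun j =>
      ⟨_, _, h1' _, h2' _, energyBounded_twist hA hφ' i j, rfl⟩
    have hholder : ∀ {v v' : S.D} {ζ : Fin (m + 1) → Z}, S.EnergyBounded ω T K v →
        S.EnergyBounded ω T K v' → S.mu ω v = 0 → S.mu ω v' = 0 → S.modulus ω K v v' ≤ M →
        (∀ j, S.Twisted ω T K (p j) (ζ j)) →
        |S.integral (v - v' : S.D) ζ| ≤ holderConst m * (P * M) := by
      intro v v' ζ hv hv' hm hm' hmod hζ
      refine (abs_integral_sub_le_of_twisted hA hO hK hv hv' (hm.trans hm'.symm) hp0 hζ).trans ?_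
      rw [mul_assoc]
      exact mul_le_mul_of_nonneg_left
        (mul_le_mul hPi hmod (modulus_nonneg hA hK hv hv') hP0.le) hH.le
    have hfirst := hholder (hφ i) (hφ' i) (hμ i) (hμ' i) (hM i) hΓt
    have hsecond := (S.integral (φ' i)).abs_sub_le_of_update Γ Γ'
      ((boundConst m + holderConst m) * R) (by
        intro s j hj
        have hpw : ∀ k, S.Twisted ω T K (p k) (s.piecewise Γ Γ' k) := by
          intro k
          by_cases hk : k ∈ s
          · simpa [hk] using hΓt k
          · simpa [hk] using hΓt' k
        -- The first part yields the term linear in d; the exact part is integrated by parts, so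
        -- that the difference of potentials becomes the integrand.
        have hsplit : Γ j - Γ' j = (θ (i.succAbove j) - θ' (i.succAbove j)) +
            S.ddc (twist φ i j - twist φ' i j) := by
          rw [map_sub]
          simp only [hΓ, hΓ']
          abel
        rw [hsplit, MultilinearMap.map_update_add, integral_ddc_symm]
        have ha := abs_integral_le_of_normalized hA (hφ' i) (hμ' i)
          (ζ := Function.update (s.piecewise Γ Γ') j (θ (i.succAbove j) - θ' (i.succAbove j)))
          (b := Function.update (fun k => 2 * (1 + p k)) j d)
          (fun k => by
            by_cases hk : k = j
            · subst hk; simpa using hd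
            · simp only [Function.update_of_ne hk]; linarith [hp0 k])
          (fun k => by
            by_cases hk : k = j
            · subst hk
              simpa using dominated_of_le hA hTK (hd1 _) (hd2 _)
            · simpa only [Function.update_of_ne hk] using (hpw k).dominated hA (hp0 k))
        -- The slot now contains ddᶜ(φ' i), a twisted form with θ = 0.
        have hb := hholder (energyBounded_twist hA hφ i j) (energyBounded_twist hA hφ' i j)
          (mu_twist hμ i j) (mu_twist hμ' i j) (modulus_twist_le hM0 hM i j)
          (ζ := Function.update (s.piecewise Γ Γ') j (S.ddc (φ' i))) (fun k => by
            by_cases hk : k = j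
            · subst hk
              refine ⟨0, φ' i, smul_nonneg (hp0 _) hA.nonneg, ?_, hφ' i, by simp⟩
              rw [neg_zero]
              exact smul_nonneg (hp0 _) hA.nonneg
            · simpa only [Function.update_of_ne hk] using hpw k)
        have hprod : ∏ k, Function.update (fun k => 2 * (1 + p k)) j d k ≤
            d * (2 ^ (m + 1) * P) := by
          have hQ : 0 ≤ ∏ k : Fin m, (1 + p (j.succAbove k)) :=
            Finset.prod_nonneg fun k _ => by linarith [hp0 (j.succAbove k)]
          rw [Fin.prod_univ_succAbove _ j]
          simp only [Function.update_self, Function.update_of_ne (Fin.succAbove_ne j _)]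
          rw [Finset.prod_mul_distrib]
          simp only [Finset.prod_const, Finset.card_univ, Fintype.card_fin]
          refine mul_le_mul_of_nonneg_left ?_ hd
          have h5 : ∏ k : Fin m, (1 + p (j.succAbove k)) ≤ P := by
            refine le_trans ?_ hPi
            rw [Fin.prod_univ_succAbove (fun k => 1 + p k) j]
            exact le_mul_of_one_le_left hQ (by linarith [hp0 j])
          exact mul_le_mul (pow_le_pow_right₀ one_le_two (Nat.le_succ m)) h5 hQ (by positivity)
        have hc : (0 : ℝ) ≤ ((m + 2) ^ (m + 3) + 1) * (S.vol ω * K) := by positivity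
        have ha' := ha.trans (mul_le_mul_of_nonneg_right hprod hc)
        have e : d * (2 ^ (m + 1) * P) * (((m + 2 : ℝ) ^ (m + 3) + 1) * (S.vol ω * K)) =
            boundConst m * (P * (d * (S.vol ω * K))) := by unfold boundConst; ring
        rw [e] at ha'
        have h6 : 0 ≤ holderConst m * (P * (d * (S.vol ω * K))) := by positivity
        have h7 : 0 ≤ boundConst m * (P * M) := by positivity
        refine (abs_add_le _ _).trans ((add_le_add ha' hb).trans ?_)
        rw [hR]
        linarith)
    have hsum : S.integral (φ i) Γ - S.integral (φ' i) Γ' =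
        S.integral (φ i - φ' i : S.D) Γ +
          (S.integral (φ' i) Γ - S.integral (φ' i) Γ') := by
      rw [Submodule.coe_sub, integral_sub]; ring
    have h8 : holderConst m * (P * M) ≤ (boundConst m + holderConst m) * R := by
      have h6 : 0 ≤ holderConst m * (P * (d * (S.vol ω * K))) := by positivity
      have h7 : 0 ≤ boundConst m * R := by positivity
      rw [hR] at h7 ⊢
      linarith
    push_cast at hsecond
    rw [hsum]
    refine (abs_add_le _ _).trans ((add_le_add (hfirst.trans h8) hsecond).trans (le_of_eq ?_))
    ring
  refine (Finset.abs_sum_le_sum_abs _ _).trans ((Finset.sum_le_sum hterm).trans (le_of_eq ?_))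
  simp only [Finset.sum_const, Finset.card_univ, Fintype.card_fin, nsmul_eq_mul]
  push_cast
  ring

/-- The constant in B exceeds the factor 8 · 2ᵐ of the midpoint estimate, so Q / B ≤ J_ω(φ, φ') / K.
-/
theorem modulus_le_dirichlet (hA : S.Admissible ω T) (hK : 0 < K) {φ φ' : S.D}
    (hφ : S.EnergyBounded ω T K φ) (hφ' : S.EnergyBounded ω T K φ') :
    S.modulus ω K φ φ' ≤ 36 * (m + 2) ^ (m + 3) * (S.vol ω *
      (S.dirichlet ω φ φ' ^ ((1 / 2 : ℝ) ^ (m + 1)) * K ^ (1 - (1 / 2 : ℝ) ^ (m + 1)))) := by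
  have hV := hA.vol_pos
  have hB := aprioriBound_pos hA hK
  have hJ := S.dirichlet_nonneg hV hφ.1 hφ'.1
  have hQ := midForm_nonneg hA hφ hφ'
  have h1 : S.midForm ω φ φ' ≤ 8 * 2 ^ m * (S.vol ω * S.dirichlet ω φ φ') :=
    S.dirForm_midpoint_le_dirichlet hV hφ.1 hφ'.1
  have h2 : S.midForm ω φ φ' / S.aprioriBound ω K ≤ S.dirichlet ω φ φ' / K := by
    rw [div_le_div_iff₀ hB hK]
    have h3 : (2 : ℝ) ^ m ≤ (m + 2) ^ (m + 3) := by
      calc (2 : ℝ) ^ m ≤ 2 ^ (m + 3) := pow_le_pow_right₀ one_le_two (by omega)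
        _ ≤ _ := by gcongr; linarith [(Nat.cast_nonneg m : (0 : ℝ) ≤ m)]
    have h4 : (8 * 2 ^ m : ℝ) ≤ 36 * (m + 2) ^ (m + 3) := by
      have : (0 : ℝ) ≤ 2 ^ m := by positivity
      linarith
    have h5 : 0 ≤ S.vol ω * S.dirichlet ω φ φ' * K := by positivity
    calc S.midForm ω φ φ' * K ≤ 8 * 2 ^ m * (S.vol ω * S.dirichlet ω φ φ') * K := by gcongr
      _ = 8 * 2 ^ m * (S.vol ω * S.dirichlet ω φ φ' * K) := by ring
      _ ≤ 36 * (m + 2) ^ (m + 3) * (S.vol ω * S.dirichlet ω φ φ' * K) :=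
        mul_le_mul_of_nonneg_right h4 h5
      _ = _ := by unfold aprioriBound; ring
  have h6 : (S.midForm ω φ φ' / S.aprioriBound ω K) ^ ((1 / 2 : ℝ) ^ (m + 1)) ≤
      (S.dirichlet ω φ φ' / K) ^ ((1 / 2 : ℝ) ^ (m + 1)) := by
    gcongr
  refine (mul_le_mul_of_nonneg_left h6 hB.le).trans (le_of_eq ?_)
  rw [Real.div_rpow hJ hK.le, Real.rpow_sub hK, Real.rpow_one, aprioriBound]
  ring

end PluripotentialSetup

end

/-! ### The main theorem -/

theorem mainTheorem8 (n : ℕ) (hn : 1 ≤ n) :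
    ∃ C : ℝ, 0 < C ∧
      ∀ (X : Type*) [TopologicalSpace X] [CompactSpace X] [T2Space X]
        (Z : Type*) [AddCommGroup Z] [Module ℝ Z] [PartialOrder Z] [IsOrderedAddMonoid Z]
        [IsOrderedModule ℝ Z] (S : PluripotentialSetup X Z n) (ω : Z),
        0 ≤ ω → S.cls ω ∈ S.Pos → S.Orthogonality ω → S.SubmeanProperty →
        (∀ (θ θ' : Fin (n + 1) → Z) (φ φ' : Fin (n + 1) → S.D) (A J α : ℝ),
          (∀ i, FormBounded ω (θ i)) → (∀ i, FormBounded ω (θ' i)) →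
          (∀ i, φ i ∈ S.psh ω) → (∀ i, φ' i ∈ S.psh ω) →
          (∀ i, S.mu ω (φ i) = 0) → (∀ i, S.mu ω (φ' i) = 0) →
          A = S.vol ω * ∏ i, (1 + formNorm ω (θ i) + formNorm ω (θ' i)) →
          J = (⨆ i, max (S.Jplus ω (φ i)) (S.Jplus ω (φ' i))) →
          α = (1 / 2 : ℝ) ^ n →
          |S.pairing θ φ - S.pairing θ' φ'| ≤
            C * (A * ((⨆ i, formNorm ω (θ i - θ' i)) * J +
              (⨆ i, S.dirichlet ω (φ i) (φ' i) ^ α) * J ^ (1 - α)))) ∧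
        (∀ (θ : Fin (n + 1) → Z) (φ : Fin (n + 1) → S.D),
          (∀ i, FormBounded ω (θ i)) → (∀ i, φ i ∈ S.psh ω) → (∀ i, S.mu ω (φ i) = 0) →
          |S.pairing θ φ| ≤
            C * (S.vol ω * (∏ i, (1 + formNorm ω (θ i))) * ⨆ i, S.Jplus ω (φ i))) := by
  obtain ⟨m, rfl⟩ : ∃ m, n = m + 1 := ⟨n - 1, by omega⟩
  have hB := PluripotentialSetup.boundConst_pos m
  have hH := PluripotentialSetup.holderConst_pos m
  set c : ℝ := 36 * (m + 2) ^ (m + 3) with hc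
  have hc1 : 1 ≤ c := by
    have h1 : (1 : ℝ) ≤ (m + 2) ^ (m + 3) :=
      one_le_pow₀ (by linarith [(Nat.cast_nonneg m : (0 : ℝ) ≤ m)])
    linarith
  set C1 : ℝ := (m + 2) ^ 2 * (PluripotentialSetup.boundConst m + PluripotentialSetup.holderConst m) with hC1
  have hC1p : 0 < C1 := by positivity
  set C2 : ℝ := (m + 2) * PluripotentialSetup.boundConst m with hC2
  have hC2p : 0 < C2 := by positivity
  -- C1 * c serves the difference estimate, C2 the bound of a single pairing.
  refine ⟨C1 * c + C2, by positivity, ?_⟩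
  intro X _ _ _ Z _ _ _ _ _ S ω hω0 hω hO hSub
  have hV := S.vol_pos hω0 hω
  have hX : Nonempty X := S.nonempty_of_vol_pos hV
  have hA : S.Admissible ω (S.submeanConst ω) :=
    ⟨hω0, hV, S.submeanBound_submeanConst (hSub.bddAbove hω0 hω)⟩
  have hT0 := S.submeanBound_nonneg hω0 hA.submean
  have hJp : ∀ φ ∈ S.psh ω, 0 ≤ S.Jplus ω φ := fun φ hφ =>
    add_nonneg (S.dirichlet_nonneg hV (S.zero_mem_psh hω0) hφ) hT0
  have hnorm : ∀ {θ : Z}, FormBounded ω θ → 0 ≤ formNorm ω θ := fun h => (S.formNorm_mem h).1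
  constructor
  · intro θ θ' φ φ' A J α hθ hθ' hφ hφ' hμ hμ' hAdef hJ hα
    subst hAdef hα
    set α : ℝ := (1 / 2 : ℝ) ^ (m + 1) with hα
    have hα1 : 0 < 1 - α := by
      have : α < 1 := pow_lt_one₀ (by norm_num) (by norm_num) (by omega)
      linarith
    set d := ⨆ i, formNorm ω (θ i - θ' i) with hd
    set e := ⨆ i, S.dirichlet ω (φ i) (φ' i) ^ α with he
    have hdi : ∀ i, formNorm ω (θ i - θ' i) ≤ d := fun i =>
      le_ciSup (f := fun i => formNorm ω (θ i - θ' i)) (Set.finite_range _).bddAbove i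
    have hei : ∀ i, S.dirichlet ω (φ i) (φ' i) ^ α ≤ e := fun i =>
      le_ciSup (f := fun i => S.dirichlet ω (φ i) (φ' i) ^ α) (Set.finite_range _).bddAbove i
    have hJi : ∀ i, max (S.Jplus ω (φ i)) (S.Jplus ω (φ' i)) ≤ J := fun i => by
      rw [hJ]
      exact le_ciSup (f := fun i => max (S.Jplus ω (φ i)) (S.Jplus ω (φ' i)))
        (Set.finite_range _).bddAbove i
    have hJ0 : 0 ≤ J := (hJp _ (hφ 0)).trans ((le_max_left _ _).trans (hJi 0))
    have hd0 : 0 ≤ d := (hnorm (PluripotentialSetup.formBounded_sub (hθ 0) (hθ' 0))).trans (hdi 0)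
    have he0 : 0 ≤ e :=
      (Real.rpow_nonneg (S.dirichlet_nonneg hV (hφ 0) (hφ' 0)) _).trans (hei 0)
    set P := ∏ i, (1 + formNorm ω (θ i) + formNorm ω (θ' i)) with hP
    have hP0 : 0 ≤ P := Finset.prod_nonneg fun i _ => by
      linarith [hnorm (hθ i), hnorm (hθ' i)]
    have hsmul : ∀ {x y : ℝ}, x ≤ y → x • ω ≤ y • ω := fun h =>
      smul_le_smul_of_nonneg_right h hω0
    -- The estimates divide by K, and J may be 0; so they are proved for K > J, and K decreases to J
    -- by continuity of K ↦ K^(1 - α).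
    have key : ∀ K, J < K → |S.pairing θ φ - S.pairing θ' φ'| ≤
        (C1 * c + C2) * (S.vol ω * P * (d * K + e * K ^ (1 - α))) := by
      intro K hJK
      have hK : 0 < K := hJ0.trans_lt hJK
      have hKp : 0 ≤ K ^ (1 - α) := Real.rpow_nonneg hK.le _
      have hφK : ∀ i, S.EnergyBounded ω (S.submeanConst ω) K (φ i) := fun i =>
        ⟨hφ i, ((le_max_left _ _).trans (hJi i)).trans hJK.le⟩
      have hφK' : ∀ i, S.EnergyBounded ω (S.submeanConst ω) K (φ' i) := fun i =>
        ⟨hφ' i, ((le_max_right _ _).trans (hJi i)).trans hJK.le⟩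
      have h1 := PluripotentialSetup.abs_pairing_sub_le hA hO hK (θ := θ) (θ' := θ') (φ := φ) (φ' := φ')
        (β := fun i => formNorm ω (θ i) + formNorm ω (θ' i)) (d := d)
        (M := c * (S.vol ω * (e * K ^ (1 - α))))
        (fun i => add_nonneg (hnorm (hθ i)) (hnorm (hθ' i)))
        (fun i => (S.formNorm_mem (hθ i)).2.1.trans (hsmul (by linarith [hnorm (hθ' i)])))
        (fun i => (S.formNorm_mem (hθ i)).2.2.trans (hsmul (by linarith [hnorm (hθ' i)])))
        (fun i => (S.formNorm_mem (hθ' i)).2.1.trans (hsmul (by linarith [hnorm (hθ i)])))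
        (fun i => (S.formNorm_mem (hθ' i)).2.2.trans (hsmul (by linarith [hnorm (hθ i)])))
        hd0
        (fun i => (S.formNorm_mem (PluripotentialSetup.formBounded_sub (hθ i) (hθ' i))).2.1.trans (hsmul (hdi i)))
        (fun i => (S.formNorm_mem (PluripotentialSetup.formBounded_sub (hθ i) (hθ' i))).2.2.trans (hsmul (hdi i)))
        hφK hφK' hμ hμ' (fun i => by
          refine (PluripotentialSetup.modulus_le_dirichlet hA hK (hφK i) (hφK' i)).trans ?_
          have := hei i
          gcongr)
      have eP : ∏ i, (1 + (formNorm ω (θ i) + formNorm ω (θ' i))) = P :=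
        Finset.prod_congr rfl fun i _ => by ring
      rw [eP] at h1
      have hE : 0 ≤ d * K := by positivity
      have hF : 0 ≤ e * K ^ (1 - α) := by positivity
      have hG : d * (S.vol ω * K) + c * (S.vol ω * (e * K ^ (1 - α))) ≤
          c * (S.vol ω * (d * K + e * K ^ (1 - α))) := by
        have := le_mul_of_one_le_left (mul_nonneg hV.le hE) hc1
        linarith
      have hR : 0 ≤ S.vol ω * P * (d * K + e * K ^ (1 - α)) := by positivity
      calc _ ≤ _ := h1
        _ ≤ C1 * (P * (c * (S.vol ω * (d * K + e * K ^ (1 - α))))) := by gcongr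
        _ = C1 * c * (S.vol ω * P * (d * K + e * K ^ (1 - α))) := by ring
        _ ≤ _ := by
          have := mul_nonneg hC2p.le hR
          linarith
    have hcont : ContinuousAt (fun K : ℝ =>
        (C1 * c + C2) * (S.vol ω * P * (d * K + e * K ^ (1 - α)))) J :=
      continuousAt_const.mul (continuousAt_const.mul ((continuousAt_const.mul continuousAt_id).add
        (continuousAt_const.mul (Real.continuousAt_rpow_const _ _ (Or.inr hα1.le)))))
    have hlim := hcont.tendsto.mono_left (nhdsWithin_le_nhds (s := Set.Ioi J))
    exact ge_of_tendsto hlim (Filter.eventually_of_mem self_mem_nhdsWithin key)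
  · intro θ φ hθ hφ hμ
    set J := ⨆ i, S.Jplus ω (φ i) with hJ
    have hJi : ∀ i, S.Jplus ω (φ i) ≤ J := fun i =>
      le_ciSup (f := fun i => S.Jplus ω (φ i)) (Set.finite_range _).bddAbove i
    have hJ0 : 0 ≤ J := (hJp _ (hφ 0)).trans (hJi 0)
    have h1 := PluripotentialSetup.abs_pairing_le hA hJ0 (fun i => hnorm (hθ i))
      (fun i => (S.formNorm_mem (hθ i)).2.1) (fun i => (S.formNorm_mem (hθ i)).2.2)
      (fun i => ⟨hφ i, hJi i⟩) hμ
    have hP0 : 0 ≤ ∏ i, (1 + formNorm ω (θ i)) := Finset.prod_nonneg fun i _ => by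
      linarith [hnorm (hθ i)]
    have hR : 0 ≤ C1 * c * (S.vol ω * (∏ i, (1 + formNorm ω (θ i))) * J) := by positivity
    linarith
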